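/- **Setting.** Let $E$ be a compact metric space with its Borel $\sigma$-field, $T:E\to E$ continuous, and $\mu$ a $T$-invariant Borel probability measure which is the only $T$-invariant Borel probability measure. Let $f:E\to[0,1]$ be continuous, $\beta>0$, $J>0$, and fix $x\in E$. For $\sigma\in\{-1,+1\}^n$ put $M_n(\sigma)=\sum_{i=1}^n\sigma_i$. Let $\mathbb Q_{n,x}$ be the probability measure on $\{-1,+1\}^n$ with $$\mathbb Q_{n,x}(\sigma)\ \propto\ \exp\Big(\frac{\beta J}{2n}M_n(\sigma)^2\Big)\prod_{i:\,\sigma_i=1} f(T^ix)\prod_{i:\,\sigma_i=-1}\big(1-f(T^ix)\big).$$ (If $0<f(T^ix)<1$ for $1\le i\le n$, this is the Gibbs measure proportional to $e^{H_{n,x}(\sigma)}$, where $H_{n,x}(\sigma)=\frac{\beta J}{2n}M_n(\sigma)^2+\frac12\sum_{i=1}^n\log\big(\tfrac{f(T^ix)}{1-f(T^ix)}\big)\sigma_i$.) Let $L(\phi,s)=\log(\phi e^{s}+(1-\phi)e^{-s})$ and $$G_n(s)=\frac{\beta J}{2}s^2-\frac1n\sum_{i=1}^nL(f(T^ix),\beta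 Js),\qquad G(s)=\frac{\beta J}{2}s^2-\int_EL(f(y),\beta Js)\,d\mu(y).$$ For $\alpha\in[0,1]$ let $\mathcal C_\alpha(S)$ be the class of $\mu$-integrable $u:E\to\mathbb R$ such that, for every $z\in E$, $\sum_{k=1}^n\big(u(T^kz)-\int_E u\,d\mu\big)=o(n^\alpha)$ as $n\to\infty$. Finally let $$\Lambda(t)=\int_EL(f(y),t)\,d\mu(y),\qquad \Lambda^*(z)=\sup_{t\in\mathbb R}\{tz-\Lambda(t)\}\in[0,\infty].$$ **Theorem.** The set $\{m_1,\dots,m_r\}$ of points where $G$ attains its global minimum is non-empty and finite. For each $i$, the type $\min\{j\ge1: G^{(j)}(m_i)\ne0\}$ of $m_i$ exists and is an even number $2k_i$, and its strength $\lambda_i=G^{(2k_i)}(m_i)$ is positive. Moreover: 1. Assume that for every $i\in\{1,\dots,r\}$ and $j\in\{1,\dots,2k_i\}$ the function $y\mapsto\frac{\partial^j}{\partial s^j}L(f(y),s)\big|_{s=\beta Jm_i}$ belongs to $\mathcal C_{j/(2k_i)}(S)$. Put $$b_{i,n}=n^{-1/(2k_i)}\,e^{-nG_n(m_i)}\,\lambda_i^{-1/(2k_i)}\int_{-\infty}^{+\infty}\exp\!\Big(-\frac{s^{2k_i}}{(2k_i)!}\Big)ds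 .$$ Then for every bounded continuous $h:\mathbb R\to\mathbb R$, $$\mathbb E_{\mathbb Q_{n,x}}\big[h(M_n/n)\big]-\frac{\sum_{i=1}^rb_{i,n}h(m_i)}{\sum_{i=1}^rb_{i,n}}\ \longrightarrow\ 0\qquad(n\to\infty).$$ In particular, if $G$ attains its minimum at a unique point $m$, then the distribution of $M_n/n$ under $\mathbb Q_{n,x}$ converges weakly to $\delta_m$. 2. (Without the assumption of part 1.) The function $$I_{\beta,x}(z)=\Lambda^*(z)-\frac{\beta J}{2}z^2-\inf_{w\in\mathbb R}\Big\{\Lambda^*(w)-\frac{\beta J}{2}w^2\Big\}$$ is a good rate function on $\mathbb R$ (it takes values in $[0,\infty]$, is lower semicontinuous, and has compact level sets), and the distribution of $M_n/n$ under $\mathbb Q_{n,x}$ satisfies the large deviation principle with speed $n$ and rate function $I_{\beta,x}$: for every Borel set $B\subset\mathbb R$, $$-\inf_{B^\circ}I_{\beta,x}\le\liminf_n\tfrac1n\log\mathbb Q_{n,x}(M_n/n\in B)\le\limsup_n\tfrac1n\log\mathbb Q_{n,x}(M_n/n\in B)\le-\inf_{\bar B}I_{\beta,x}.$$ -/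

import Mathlib

open MeasureTheory Filter Topology
open scoped BoundedContinuousFunction

namespace RandomFieldCurieWeiss

/-- `μ` is `T`-invariant and is the only `T`-invariant probability measure. -/
def UniquelyErgodic {E : Type*} [MeasurableSpace E] (T : E → E) (μ : Measure E) : Prop :=
  MeasurePreserving T μ μ ∧
    ∀ ν : Measure E, IsProbabilityMeasure ν → MeasurePreserving T ν ν → ν = μ

/-- The class `C_α(S)`: the `μ`-integrable functions `h` on `E` such that, for **every** `x`,
`∑_{k=1}^n (h (T^k x) - ∫ h dμ) = o(n^α)`. -/
def DiscrepancyClass {E : Type*} [MeasurableSpace E] (T : E → E) (μ : Measure E) (α : ℝ) :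
    Set (E → ℝ) :=
  {h | Integrable h μ ∧ ∀ x : E,
    (fun n : ℕ => ∑ k ∈ Finset.Icc 1 n, (h (T^[k] x) - ∫ y, h y ∂μ))
      =o[atTop] (fun n : ℕ => (n : ℝ) ^ α)}

/-! ### The model -/

instance instMeasurableSingletonClassSpin : MeasurableSingletonClass ℤˣ :=
  ⟨fun u => ⟨{(u : ℤ)}, measurableSet_singleton _, by ext v; simp [Units.ext_iff]⟩⟩

/-- Spin configurations `{-1, +1}^n`; coordinate `i : Fin n` is the site number `i + 1`. -/
abbrev Config (n : ℕ) : Type := Fin n → ℤˣ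

/-- The magnetization `M_n = σ_1 + ⋯ + σ_n`. -/
def magnetization {n : ℕ} (σ : Config n) : ℝ := ∑ i, ((σ i : ℤ) : ℝ)

/-- The law on `{-1, +1}` of one step: `+1` with probability `p`, `-1` with probability `1 - p`. -/
noncomputable def stepProb (p : ℝ) (u : ℤˣ) : ℝ := if u = 1 then p else 1 - p

/-- The Hamiltonian. It is meaningful when `0 < f (T^i x) < 1` for `i = 1, …, n`. -/
noncomputable def hamiltonian {E : Type*} (T : E → E) (f : E → unitInterval) (β J : ℝ) (x : E) {n : ℕ}
    (σ : Config n) : ℝ :=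
  β * J / (2 * n) * magnetization σ ^ 2 +
    1 / 2 * ∑ i : Fin n,
      Real.log ((f (T^[i + 1] x) : ℝ) / (1 - (f (T^[i + 1] x) : ℝ))) * ((σ i : ℤ) : ℝ)

/-- The unnormalized Gibbs weight of a configuration, with respect to the law of the first `n`
steps of the dynamic random walk. It makes sense also when `f` takes the values `0` and `1`;
otherwise it gives the same probabilities as the weight `exp H_{n,x}`, see `gibbsProb_eq`. -/
noncomputable def gibbsWeight {E : Type*} (T : E → E) (f : E → unitInterval) (β J : ℝ) (x : E) {n : ℕ}
    (σ : Config n) : ℝ :=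
  Real.exp (β * J / (2 * n) * magnetization σ ^ 2) *
    ∏ i : Fin n, stepProb (f (T^[i + 1] x)) (σ i)

/-- The Gibbs probability `Q_{n,x}(σ)` of a configuration. -/
noncomputable def gibbsProb {E : Type*} (T : E → E) (f : E → unitInterval) (β J : ℝ) (x : E) {n : ℕ}
    (σ : Config n) : ℝ :=
  gibbsWeight T f β J x σ / ∑ τ : Config n, gibbsWeight T f β J x τ

/-- The Gibbs measure `Q_{n,x}` on `{-1, +1}^n`. -/
noncomputable def gibbsMeasure {E : Type*} (T : E → E) (f : E → unitInterval) (β J : ℝ) (x : E) (n : ℕ) :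
    Measure (Config n) :=
  ∑ σ : Config n, ENNReal.ofReal (gibbsProb T f β J x σ) • Measure.dirac σ

theorem units_int_univ : (Finset.univ : Finset ℤˣ) = {1, -1} := rfl

theorem stepProb_nonneg (p : unitInterval) (u : ℤˣ) : 0 ≤ stepProb p u := by
  unfold stepProb
  split_ifs
  · exact p.2.1
  · linarith [p.2.2]

theorem sum_stepProb (p : ℝ) : ∑ u : ℤˣ, stepProb p u = 1 := by
  rw [units_int_univ, Finset.sum_pair (by decide)]
  simp [stepProb]

theorem gibbsWeight_nonneg {E : Type*} (T : E → E) (f : E → unitInterval) (β J : ℝ) (x : E) {n : ℕ}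
    (σ : Config n) : 0 ≤ gibbsWeight T f β J x σ :=
  mul_nonneg (Real.exp_pos _).le (Finset.prod_nonneg fun _ _ => stepProb_nonneg _ _)

theorem sum_gibbsWeight_pos {E : Type*} (T : E → E) (f : E → unitInterval) (β J : ℝ) (x : E) (n : ℕ) :
    0 < ∑ σ : Config n, gibbsWeight T f β J x σ := by
  have h1 : ∑ σ : Config n, ∏ i : Fin n, stepProb (f (T^[i + 1] x)) (σ i) = 1 := by
    rw [← Fintype.prod_sum (fun (i : Fin n) (u : ℤˣ) => stepProb (f (T^[i + 1] x)) u)]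
    exact Finset.prod_eq_one fun i _ => sum_stepProb _
  obtain ⟨σ, -, hσ⟩ : ∃ σ ∈ (Finset.univ : Finset (Config n)),
      0 < ∏ i : Fin n, stepProb (f (T^[i + 1] x)) (σ i) := by
    apply Finset.exists_lt_of_sum_lt
    rw [h1, Finset.sum_const_zero]
    exact one_pos
  exact Finset.sum_pos' (fun τ _ => gibbsWeight_nonneg T f β J x τ)
    ⟨σ, Finset.mem_univ _, mul_pos (Real.exp_pos _) hσ⟩

instance gibbsMeasure_isProbabilityMeasure {E : Type*} (T : E → E) (f : E → unitInterval) (β J : ℝ)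
    (x : E) (n : ℕ) : IsProbabilityMeasure (gibbsMeasure T f β J x n) := by
  constructor
  have hZ := sum_gibbsWeight_pos T f β J x n
  simp only [gibbsMeasure, Measure.coe_finsetSum, Finset.sum_apply, Measure.smul_apply,
    measure_univ, smul_eq_mul, mul_one]
  simp only [gibbsProb]
  rw [← ENNReal.ofReal_sum_of_nonneg
    (fun σ _ => div_nonneg (gibbsWeight_nonneg T f β J x σ) hZ.le)]
  rw [← Finset.sum_div, div_self hZ.ne', ENNReal.ofReal_one]

/-- If `0 < f (T^i x) < 1` for `i = 1, …, n`, then `Q_{n,x}(σ) = exp H_{n,x}(σ) / Z_{n,x}`. -/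
theorem gibbsProb_eq {E : Type*} (T : E → E) (f : E → unitInterval) (β J : ℝ) (x : E) {n : ℕ}
    (h0 : ∀ i : Fin n, 0 < (f (T^[i + 1] x) : ℝ)) (h1 : ∀ i : Fin n, (f (T^[i + 1] x) : ℝ) < 1)
    (σ : Config n) :
    gibbsProb T f β J x σ = Real.exp (hamiltonian T f β J x σ) /
      ∑ τ : Config n, Real.exp (hamiltonian T f β J x τ) := by
  have step : ∀ (p : ℝ), 0 < p → p < 1 → ∀ u : ℤˣ, stepProb p u =
      Real.exp (1 / 2 * (Real.log p + Real.log (1 - p))) *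
        Real.exp (1 / 2 * (Real.log (p / (1 - p)) * ((u : ℤ) : ℝ))) := by
    intro p hp hp' u
    have hq : 0 < 1 - p := by linarith
    rw [← Real.exp_add, Real.log_div hp.ne' hq.ne']
    rcases Int.units_eq_one_or u with rfl | rfl
    · have : 1 / 2 * (Real.log p + Real.log (1 - p)) +
          1 / 2 * ((Real.log p - Real.log (1 - p)) * (((1 : ℤˣ) : ℤ) : ℝ)) = Real.log p := by
        push_cast; ring
      rw [this, Real.exp_log hp]; simp [stepProb]
    · have : 1 / 2 * (Real.log p + Real.log (1 - p)) +
          1 / 2 * ((Real.log p - Real.log (1 - p)) * (((-1 : ℤˣ) : ℤ) : ℝ)) =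
            Real.log (1 - p) := by
        push_cast; ring
      rw [this, Real.exp_log hq]; simp [stepProb]
  set c : ℝ := ∏ i : Fin n, Real.exp (1 / 2 * (Real.log (f (T^[i + 1] x) : ℝ) +
    Real.log (1 - (f (T^[i + 1] x) : ℝ)))) with hc
  have hcpos : 0 < c := Finset.prod_pos fun _ _ => Real.exp_pos _
  have key : ∀ τ : Config n,
      gibbsWeight T f β J x τ = c * Real.exp (hamiltonian T f β J x τ) := by
    intro τ
    unfold gibbsWeight hamiltonian
    rw [Finset.prod_congr rfl fun i _ => step _ (h0 i) (h1 i) (τ i), Finset.prod_mul_distrib,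
      ← hc, ← Real.exp_sum, Real.exp_add, Finset.mul_sum]
    ring
  simp only [gibbsProb, key]
  rw [← Finset.mul_sum, mul_div_mul_left _ _ hcpos.ne']

/-- The distribution of `M_n / n` under `Q_{n,x}`. -/
noncomputable def magnetizationLaw {E : Type*} (T : E → E) (f : E → unitInterval) (β J : ℝ) (x : E)
    (n : ℕ) : ProbabilityMeasure ℝ :=
  ⟨(gibbsMeasure T f β J x n).map (fun σ => magnetization σ / n),
    Measure.isProbabilityMeasure_map (measurable_of_finite _).aemeasurable⟩

/-! ### The free-energy functions -/

/-- `L(φ, s) = log (φ e^s + (1 - φ) e^{-s})`. -/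
noncomputable def L (φ s : ℝ) : ℝ := Real.log (φ * Real.exp s + (1 - φ) * Real.exp (-s))

/-- `G_n(s)`; it depends also on the point `x`. -/
noncomputable def Gn {E : Type*} (T : E → E) (f : E → unitInterval) (β J : ℝ) (x : E) (n : ℕ) (s : ℝ) : ℝ :=
  β * J / 2 * s ^ 2 - 1 / n * ∑ i ∈ Finset.Icc 1 n, L (f (T^[i] x)) (β * J * s)

/-- `G(s)`. -/
noncomputable def G {E : Type*} [MeasurableSpace E] (μ : Measure E) (f : E → unitInterval) (β J : ℝ)
    (s : ℝ) : ℝ :=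
  β * J / 2 * s ^ 2 - ∫ y, L (f y) (β * J * s) ∂μ

/-- The set of points where a function reaches its global minimum. -/
def minimizers (F : ℝ → ℝ) : Set ℝ := {m | ∀ s, F m ≤ F s}

/-- The type of a minimum `m` of `F`: the least `j ≥ 1` such that `F^(j)(m) ≠ 0`. -/
noncomputable def minType (F : ℝ → ℝ) (m : ℝ) : ℕ := sInf {j | 1 ≤ j ∧ iteratedDeriv j F m ≠ 0}

/-- The strength of a minimum `m` of `F`: `F^(p)(m)` with `p` the type of `m`. -/
noncomputable def minStrength (F : ℝ → ℝ) (m : ℝ) : ℝ := iteratedDeriv (minType F m) F m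

/-- The weight `b_{i,n}` attached to a minimum `m = m_i` of `G` (of type `2 k_i`). -/
noncomputable def weight {E : Type*} [MeasurableSpace E] (μ : Measure E) (T : E → E) (f : E → unitInterval)
    (β J : ℝ) (x : E) (m : ℝ) (n : ℕ) : ℝ :=
  (n : ℝ) ^ (-1 / (minType (G μ f β J) m : ℝ)) *
    Real.exp (-(n * Gn T f β J x n m)) *
    minStrength (G μ f β J) m ^ (-1 / (minType (G μ f β J) m : ℝ)) *
    ∫ s : ℝ, Real.exp (-(s ^ minType (G μ f β J) m / (minType (G μ f β J) m).factorial))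

/-! ### Large deviations -/

/-- A good rate function: nonnegative, lower semicontinuous, with compact level sets. -/
structure IsGoodRateFunction {Γ : Type*} [TopologicalSpace Γ] (R : Γ → EReal) : Prop where
  nonneg : ∀ z, 0 ≤ R z
  lowerSemicontinuous : LowerSemicontinuous R
  isCompact_level : ∀ a : ℝ, 0 ≤ a → IsCompact {z | R z ≤ (a : EReal)}

/-- The measures `ν n` satisfy a large deviation principle with speed `v n` and good rate
function `R`. Here `ENNReal.log 0 = ⊥`. -/
structure LargeDeviationPrinciple {Γ : Type*} [TopologicalSpace Γ] [MeasurableSpace Γ]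
    (ν : ℕ → Measure Γ) (v : ℕ → ℝ) (R : Γ → EReal) : Prop where
  speed_mono : Monotone v
  speed_tendsto : Tendsto v atTop atTop
  rate : IsGoodRateFunction R
  lower : ∀ B : Set Γ, MeasurableSet B → -(⨅ z ∈ interior B, R z) ≤
    liminf (fun n => ((1 / v n : ℝ) : EReal) * ENNReal.log (ν n B)) atTop
  upper : ∀ B : Set Γ, MeasurableSet B →
    limsup (fun n => ((1 / v n : ℝ) : EReal) * ENNReal.log (ν n B)) atTop ≤
      -(⨅ z ∈ closure B, R z)

/-- `Λ(t) = ∫ log (e^t f + (1 - f) e^{-t}) dμ`. -/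
noncomputable def Lam {E : Type*} [MeasurableSpace E] (μ : Measure E) (f : E → unitInterval) (t : ℝ) : ℝ :=
  ∫ y, L (f y) t ∂μ

/-- The Legendre transform `Λ*(z) = sup_t (t z - Λ(t))`, with values in `(-∞, ∞]`. -/
noncomputable def LamStar {E : Type*} [MeasurableSpace E] (μ : Measure E) (f : E → unitInterval) (z : ℝ) :
    EReal :=
  ⨆ t : ℝ, ((t * z - Lam μ f t : ℝ) : EReal)

/-- `Λ*(z) - (β J / 2) z²`. -/
noncomputable def tiltedRate {E : Type*} [MeasurableSpace E] (μ : Measure E) (f : E → unitInterval)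
    (β J : ℝ) (z : ℝ) : EReal :=
  LamStar μ f z - ((β * J / 2 * z ^ 2 : ℝ) : EReal)

/-- The rate function `Λ*(z) - (β J / 2) z² - inf_w (Λ*(w) - (β J / 2) w²)`. -/
noncomputable def rateFunction {E : Type*} [MeasurableSpace E] (μ : Measure E) (f : E → unitInterval)
    (β J : ℝ) (z : ℝ) : EReal :=
  tiltedRate μ f β J z - ⨅ w : ℝ, tiltedRate μ f β J w

end RandomFieldCurieWeiss

namespace RandomFieldCurieWeiss

open scoped ContDiff

/-! Every function involved is an average of `L (f y)` over a probability measure on `E`: `G` uses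
`μ`, and `Gn` is the same functional of the empirical measure of the orbit (`Gn_eq_G`). Bounds on
`L` and its derivatives that are uniform in `φ ∈ [0,1]` therefore hold for `G` and for all `Gn`, `n
≥ 1`, at once. Unique ergodicity and compactness give pointwise convergence of `Gn` to `G` along
every orbit (`UniquelyErgodic.tendsto_integral_empiricalMeasure`).

Minima. Factorial bounds on the derivatives make `G` analytic in effect; since it also grows
quadratically, its derivatives cannot all vanish at one point. Every minimum thus has a finite type,
Taylor's formula gives an even type and positive strength, and minima are isolated inside a compact
interval.

Part 1. By the Hubbard–Stratonovich transformation (`exp_neg_mul_Gn_eq`), the density proportional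
to `exp (-n Gn)` is the law of `M_n / n` smoothed by a Gaussian of variance `1 / (n β J)`, so Gibbs
expectations can be replaced by Laplace integrals. Near a minimum of type `p` one rescales by
`n^(1/p)`; the discrepancy assumption says exactly that the lower Taylor coefficients of `Gn`
disappear at that scale (`tendsto_rpow_mul_iteratedDeriv_Gn`), and dominated convergence applies
(`tendsto_local_laplace`). Away from the minima the integral is exponentially small. The weights
keep the factor `exp (-n Gn m)` because `n (Gn m - G m)` need not converge; only ratios to the
weights are shown to converge.

Part 2. The logarithmic moment generating function of the walk without interaction is exactly `n
Λ_n`, with `Λ_n` the function `Lam` of the empirical measure. Exponential Chebyshev bounds and a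
covering of a compact set give the upper bound for Gibbs masses (`eventually_gibbsMass_le`); a
change of measure at slopes `Λ'(t)` gives the lower bound (`eventually_le_gibbsMass`). The
interaction is a continuous function of `M_n / n` and is carried along locally. Dividing by the
total mass, whose rate is the infimum of `tiltedRate`, gives the principle. -/

/-! ### Derivatives of `L` -/

/-- `φ e^s + (1 - φ) e^{-s}`. -/
noncomputable def stepMGF (φ s : ℝ) : ℝ := φ * Real.exp s + (1 - φ) * Real.exp (-s)

/-- The derivative of `L φ`. -/
noncomputable def tiltedMean (φ s : ℝ) : ℝ :=
  (φ * Real.exp s - (1 - φ) * Real.exp (-s)) / stepMGF φ s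

theorem exp_neg_abs_le_stepMGF (φ : unitInterval) (s : ℝ) : Real.exp (-|s|) ≤ stepMGF φ s := by
  have h0 := φ.2.1
  have h1 := φ.2.2
  have h2 : Real.exp (-|s|) ≤ Real.exp s := Real.exp_le_exp.2 (neg_abs_le s)
  have h3 : Real.exp (-|s|) ≤ Real.exp (-s) := Real.exp_le_exp.2 (neg_le_neg (le_abs_self s))
  unfold stepMGF
  nlinarith

theorem stepMGF_le_exp_abs (φ : unitInterval) (s : ℝ) : stepMGF φ s ≤ Real.exp |s| := by
  have h0 := φ.2.1
  have h1 := φ.2.2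
  have h2 : Real.exp s ≤ Real.exp |s| := Real.exp_le_exp.2 (le_abs_self s)
  have h3 : Real.exp (-s) ≤ Real.exp |s| := Real.exp_le_exp.2 (neg_le_abs s)
  unfold stepMGF
  nlinarith

theorem stepMGF_pos (φ : unitInterval) (s : ℝ) : 0 < stepMGF φ s :=
  (Real.exp_pos _).trans_le (exp_neg_abs_le_stepMGF φ s)

theorem exp_L (φ : unitInterval) (s : ℝ) : Real.exp (L φ s) = stepMGF φ s :=
  Real.exp_log (stepMGF_pos φ s)

theorem abs_L_le (φ : unitInterval) (s : ℝ) : |L φ s| ≤ |s| := by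
  have h := exp_L φ s
  rw [abs_le]
  constructor
  · rw [← Real.exp_le_exp, h]; exact exp_neg_abs_le_stepMGF φ s
  · rw [← Real.exp_le_exp, h]; exact stepMGF_le_exp_abs φ s

theorem L_zero (φ : ℝ) : L φ 0 = 0 := by simp [L]

theorem abs_tiltedMean_le_one (φ : unitInterval) (s : ℝ) : |tiltedMean φ s| ≤ 1 := by
  have h0 := φ.2.1
  have h1 := φ.2.2
  have h := stepMGF_pos φ s
  have hs := Real.exp_pos s
  have hs' := Real.exp_pos (-s)
  rw [tiltedMean, abs_div, abs_of_pos h, div_le_one h, abs_le]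
  unfold stepMGF
  constructor <;> nlinarith

theorem hasDerivAt_stepMGF (φ s : ℝ) :
    HasDerivAt (stepMGF φ) (φ * Real.exp s - (1 - φ) * Real.exp (-s)) s := by
  have h1 := (Real.hasDerivAt_exp s).const_mul φ
  have h2 := ((hasDerivAt_neg s).exp).const_mul (1 - φ)
  exact (h1.add h2).congr_deriv (by ring)

theorem hasDerivAt_L (φ : unitInterval) (s : ℝ) :
    HasDerivAt (L φ) (tiltedMean φ s) s :=
  (hasDerivAt_stepMGF φ s).log (stepMGF_pos φ s).ne'

/-- The Riccati equation `u' = 1 - u²` for `u = L'` makes all higher derivatives of `L` polynomials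
in `u ∈ [-1,1]`, which is what yields bounds independent of `φ` and `s`. -/
theorem hasDerivAt_tiltedMean (φ : unitInterval) (s : ℝ) :
    HasDerivAt (tiltedMean φ) (1 - tiltedMean φ s ^ 2) s := by
  have h1 := (Real.hasDerivAt_exp s).const_mul (φ : ℝ)
  have h2 := ((hasDerivAt_neg s).exp).const_mul (1 - (φ : ℝ))
  have h := (h1.sub h2).div (hasDerivAt_stepMGF φ s) (stepMGF_pos φ s).ne'
  refine h.congr_deriv ?_
  have hne := (stepMGF_pos φ s).ne'
  unfold tiltedMean
  field_simp
  simp only [stepMGF, Pi.sub_apply]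
  ring

/-! ### Higher derivatives of `L` as polynomials in `L'`, with factorial bounds -/

section

open Polynomial

/-- The polynomials with `L^(j+1) = P_j (L')`. -/
noncomputable def derivPoly : ℕ → ℝ[X]
  | 0 => X
  | j + 1 => derivative (derivPoly j) * (1 - X ^ 2)

theorem iteratedDeriv_L (φ : unitInterval) (j : ℕ) :
    iteratedDeriv (j + 1) (L φ) = fun s => (derivPoly j).eval (tiltedMean φ s) := by
  induction j with
  | zero =>
    rw [iteratedDeriv_one]
    ext s
    simp [derivPoly, (hasDerivAt_L φ s).deriv]
  | succ j ih =>
    rw [iteratedDeriv_succ, ih]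
    ext s
    have h := ((derivPoly j).hasDerivAt (tiltedMean φ s)).comp s (hasDerivAt_tiltedMean φ s)
    have h2 := h.deriv
    simp only [Function.comp_def] at h2
    rw [h2]
    simp [derivPoly]

theorem natDegree_derivPoly_le (j : ℕ) : (derivPoly j).natDegree ≤ j + 1 := by
  induction j with
  | zero => simp [derivPoly]
  | succ j ih =>
    rw [derivPoly]
    refine natDegree_mul_le.trans ?_
    have h1 := natDegree_derivative_le (derivPoly j)
    have h2 : (1 - X ^ 2 : ℝ[X]).natDegree ≤ 2 := by
      compute_degree
    omega

/-- A bound for the sum of the absolute values of the coefficients of `P_j`. -/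
theorem sum_abs_coeff_derivPoly_le (j : ℕ) :
    ∑ i ∈ Finset.range (j + 2), |(derivPoly j).coeff i| ≤ 2 ^ j * (j.factorial * (j + 1)) := by
  -- Differentiation multiplies coefficients by at most `j + 1`, and the factor `1 - X²` at most
  -- doubles their absolute sum. So the sum grows by a factor at most `2 (j + 1)` at each step,
  -- which is of factorial order.
  induction j with
  | zero =>
    simp [derivPoly, Finset.sum_range_succ, coeff_X]
  | succ j ih =>
    set p := derivPoly j with hp
    have hcoeff : ∀ i, (derivPoly (j + 1)).coeff i =
        p.coeff (i + 1) * (i + 1) - if 2 ≤ i then p.coeff (i - 1) * (i - 1 : ℝ) else 0 := by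
      intro i
      rw [derivPoly, mul_sub, mul_one, coeff_sub, coeff_mul_X_pow', coeff_derivative]
      congr 1
      split_ifs with h
      · rw [coeff_derivative]
        obtain ⟨k, rfl⟩ := Nat.exists_eq_add_of_le' h
        simp
        norm_num [add_sub_assoc]
        exact Or.inl (by rw [hp])
      · rfl
    have hz : ∀ i, j + 2 ≤ i → p.coeff i = 0 := fun i hi =>
      coeff_eq_zero_of_natDegree_lt (by have := natDegree_derivPoly_le j; rw [hp]; omega)
    set S := ∑ i ∈ Finset.range (j + 2), |p.coeff i| with hS
    have key : ∀ i, |p.coeff i * (i : ℝ)| ≤ |p.coeff i| * (j + 1) := by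
      intro i
      rw [abs_mul, abs_of_nonneg (Nat.cast_nonneg i : (0:ℝ) ≤ i)]
      by_cases h : i ≤ j + 1
      · gcongr
        exact_mod_cast h
      · rw [hz i (by omega)]; simp
    have h1 : ∑ i ∈ Finset.range (j + 3), |p.coeff (i + 1) * ((i : ℝ) + 1)| ≤ S * (j + 1) := by
      have : ∑ i ∈ Finset.range (j + 3), |p.coeff (i + 1) * ((i : ℝ) + 1)| ≤
          ∑ i ∈ Finset.range (j + 4), |p.coeff i * (i : ℝ)| := by
        rw [Finset.sum_range_succ' _ (j + 3)]
        push_cast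
        simp
      refine this.trans ?_
      rw [Finset.sum_range_succ, Finset.sum_range_succ, hz (j + 2) (by omega),
        hz (j + 3) (by omega), hS, Finset.sum_mul]
      simpa using Finset.sum_le_sum fun i _ => key i
    have h2 : ∑ i ∈ Finset.range (j + 3),
        |if 2 ≤ i then p.coeff (i - 1) * (i - 1 : ℝ) else 0| ≤ S * (j + 1) := by
      rw [Finset.sum_range_succ', hS, Finset.sum_mul]
      simp only [nonpos_iff_eq_zero, OfNat.ofNat_ne_zero, ↓reduceIte, abs_zero, add_zero]
      refine Finset.sum_le_sum fun i _ => ?_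
      split_ifs with h
      · simpa using key i
      · simp only [abs_zero]; positivity
    calc ∑ i ∈ Finset.range (j + 1 + 2), |(derivPoly (j + 1)).coeff i|
        ≤ ∑ i ∈ Finset.range (j + 3), (|p.coeff (i + 1) * ((i : ℝ) + 1)| +
            |if 2 ≤ i then p.coeff (i - 1) * (i - 1 : ℝ) else 0|) := by
          refine Finset.sum_le_sum fun i _ => ?_
          rw [hcoeff]; exact abs_sub _ _
      _ ≤ S * (j + 1) + S * (j + 1) := by
          rw [Finset.sum_add_distrib]; exact add_le_add h1 h2
      _ ≤ _ := by
          rw [Nat.factorial_succ]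
          push_cast
          have := mul_le_mul_of_nonneg_right ih (by positivity : (0:ℝ) ≤ (j + 1))
          rw [pow_succ]
          have h3 : (0:ℝ) ≤ 2 ^ j * (j.factorial * (j + 1)) := by positivity
          nlinarith

theorem abs_eval_derivPoly_le (j : ℕ) {u : ℝ} (hu : |u| ≤ 1) :
    |(derivPoly j).eval u| ≤ 2 ^ j * (j + 1).factorial := by
  rw [eval_eq_sum_range' (n := j + 2) (by have := natDegree_derivPoly_le j; omega)]
  refine (Finset.abs_sum_le_sum_abs _ _).trans (le_trans (Finset.sum_le_sum fun i _ => ?_)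
    ((sum_abs_coeff_derivPoly_le j).trans_eq ?_))
  · rw [abs_mul, abs_pow]
    exact mul_le_of_le_one_right (abs_nonneg _) (pow_le_one₀ (abs_nonneg _) hu)
  · rw [Nat.factorial_succ]; push_cast; ring

/-- A bound, uniform in `φ` and `s`, for the derivatives of `L`. -/
theorem abs_iteratedDeriv_L_le (φ : unitInterval) (j : ℕ) (s : ℝ) :
    |iteratedDeriv (j + 1) (L φ) s| ≤ 2 ^ j * (j + 1).factorial := by
  rw [iteratedDeriv_L]
  exact abs_eval_derivPoly_le j (abs_tiltedMean_le_one φ s)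

end

theorem continuous_stepMGF (s : ℝ) : Continuous fun φ : unitInterval => stepMGF φ s := by
  unfold stepMGF; fun_prop

theorem continuous_L_left (s : ℝ) : Continuous fun φ : unitInterval => L φ s :=
  (continuous_stepMGF s).log fun φ => (stepMGF_pos φ s).ne'

theorem continuous_tiltedMean_left (s : ℝ) :
    Continuous fun φ : unitInterval => tiltedMean φ s := by
  unfold tiltedMean
  refine Continuous.div (by fun_prop) (continuous_stepMGF s) fun φ => (stepMGF_pos φ s).ne'

theorem continuous_iteratedDeriv_L_left (j : ℕ) (s : ℝ) :
    Continuous fun φ : unitInterval => iteratedDeriv j (L φ) s := by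
  cases j with
  | zero => simpa using continuous_L_left s
  | succ j =>
    simp only [iteratedDeriv_L]
    exact (derivPoly j).continuous.comp (continuous_tiltedMean_left s)

theorem hasDerivAt_iteratedDeriv_L (φ : unitInterval) (j : ℕ) (s : ℝ) :
    HasDerivAt (iteratedDeriv j (L φ)) (iteratedDeriv (j + 1) (L φ) s) s := by
  cases j with
  | zero =>
    rw [iteratedDeriv_zero, iteratedDeriv_one, (hasDerivAt_L φ s).deriv]
    exact hasDerivAt_L φ s
  | succ j =>
    rw [iteratedDeriv_L, iteratedDeriv_L, derivPoly]
    refine (((derivPoly j).hasDerivAt _).comp s (hasDerivAt_tiltedMean φ s)).congr_deriv ?_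
    simp

/-! ### Taylor expansions of smooth functions -/

theorem abs_sub_taylor_le {F : ℝ → ℝ} {p : ℕ} (hF : ContDiff ℝ (p + 1) F) {K : ℝ}
    (hK : ∀ s, |iteratedDeriv (p + 1) F s| ≤ K) (m s : ℝ) :
    |F s - ∑ j ∈ Finset.range (p + 1), iteratedDeriv j F m * (s - m) ^ j / j.factorial| ≤
      K / (p + 1).factorial * |s - m| ^ (p + 1) := by
  rcases eq_or_ne m s with rfl | hne
  · simp [Finset.sum_range_succ']
  obtain ⟨c, -, hc⟩ := taylor_mean_remainder_lagrange_iteratedDeriv hne hF.contDiffOn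
  have : taylorWithinEval F p (Set.uIcc m s) m s =
      ∑ j ∈ Finset.range (p + 1), iteratedDeriv j F m * (s - m) ^ j / j.factorial := by
    rw [taylor_within_apply]
    refine Finset.sum_congr rfl fun j hj => ?_
    rw [iteratedDerivWithin_eq_iteratedDeriv (uniqueDiffOn_uIcc hne) _ Set.left_mem_uIcc]
    · simp; ring
    · refine (hF.of_le ?_).contDiffAt
      exact_mod_cast (Finset.mem_range.1 hj).le
  rw [← this, hc, abs_div, abs_mul, abs_pow, Nat.abs_cast, mul_div_right_comm]
  gcongr
  exact hK c

/-- The Taylor expansion at a point where the derivatives of orders `1, …, p - 1` vanish. -/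
theorem abs_sub_leading_term_le {F : ℝ → ℝ} {p : ℕ} (hp : 0 < p) (hF : ContDiff ℝ (p + 1) F) {K : ℝ}
    (hK : ∀ s, |iteratedDeriv (p + 1) F s| ≤ K) {m : ℝ}
    (hm : ∀ j, 1 ≤ j → j < p → iteratedDeriv j F m = 0) (s : ℝ) :
    |F s - F m - iteratedDeriv p F m * (s - m) ^ p / p.factorial| ≤
      K / (p + 1).factorial * |s - m| ^ (p + 1) := by
  convert abs_sub_taylor_le hF hK m s using 2
  rw [Finset.sum_range_succ, ← sub_sub]
  congr 2
  obtain ⟨q, rfl⟩ := Nat.exists_eq_add_of_le' hp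
  rw [Finset.sum_range_succ', Finset.sum_eq_zero fun j hj => ?_]
  · simp
  · rw [hm (j + 1) (by omega) (by have := Finset.mem_range.1 hj; omega)]; simp

theorem exists_pos_forall_small {c K : ℝ} (hc : 0 < c) (hK : 0 ≤ K) :
    ∃ ρ > 0, ∀ t, 0 < t → t < ρ → K * t < c := by
  refine ⟨c / (K + 1), by positivity, fun t ht0 ht => ?_⟩
  rw [lt_div_iff₀ (by positivity)] at ht
  nlinarith

/-- At distance `t` small enough the term of order `p` dominates the remainder, so minimality forces
`lam * e ^ p > 0` in both directions `e = 1` and `e = -1`. The first gives the sign, the second then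
gives the parity. -/
theorem even_and_pos_of_isMin {F : ℝ → ℝ} {p : ℕ} (hp : 0 < p) (hF : ContDiff ℝ (p + 1) F) {K : ℝ}
    (hK : ∀ s, |iteratedDeriv (p + 1) F s| ≤ K) {m : ℝ}
    (hm : ∀ j, 1 ≤ j → j < p → iteratedDeriv j F m = 0) (hne : iteratedDeriv p F m ≠ 0)
    (hmin : ∀ s, F m ≤ F s) : Even p ∧ 0 < iteratedDeriv p F m := by
  set lam := iteratedDeriv p F m with hlam
  set K' := K / (p + 1).factorial with hK'
  have hK0 : 0 ≤ K' := div_nonneg ((abs_nonneg _).trans (hK 0)) (by positivity)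
  have hT := abs_sub_leading_term_le hp hF hK hm
  have hfac : (0 : ℝ) < p.factorial := by positivity
  obtain ⟨ρ, hρ, hsmall⟩ := exists_pos_forall_small (c := |lam| / p.factorial)
    (div_pos (abs_pos.2 hne) hfac) hK0
  have key : ∀ e : ℝ, |e| = 1 → 0 < lam * e ^ p := by
    intro e he
    by_contra! hcon
    have ht : 0 < ρ / 2 := by positivity
    set t := ρ / 2 with htdef
    have h1 := hT (m + e * t)
    have h2 := hmin (m + e * t)
    have h3 := hsmall t ht (by linarith)
    rw [add_sub_cancel_left, abs_mul, he, one_mul, abs_of_pos ht, mul_pow, ← mul_assoc] at h1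
    have h4 : lam * e ^ p = -|lam| := by
      rw [eq_neg_iff_add_eq_zero, ← eq_neg_iff_add_eq_zero, eq_comm, neg_eq_iff_eq_neg,
        ← abs_of_nonpos hcon, abs_mul, abs_pow, he, one_pow, mul_one]
    rw [h4] at h1
    have h5 := (abs_le.1 h1).2
    have h6 : K' * t * t ^ p < |lam| / p.factorial * t ^ p :=
      mul_lt_mul_of_pos_right h3 (by positivity)
    have h7 : -|lam| * t ^ p / p.factorial = -(|lam| / p.factorial * t ^ p) := by ring
    rw [h7, pow_succ'] at h5
    linarith
  have h1 := key 1 (by simp)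
  rw [one_pow, mul_one] at h1
  refine ⟨?_, h1⟩
  by_contra hodd
  have h2 := key (-1) (by simp)
  rw [Nat.not_even_iff_odd] at hodd
  rw [hodd.neg_one_pow] at h2
  linarith

theorem eventually_lt_of_pos {F : ℝ → ℝ} {p : ℕ} (hp : 0 < p) (hF : ContDiff ℝ (p + 1) F) {K : ℝ}
    (hK : ∀ s, |iteratedDeriv (p + 1) F s| ≤ K) {m : ℝ}
    (hm : ∀ j, 1 ≤ j → j < p → iteratedDeriv j F m = 0) (hpos : 0 < iteratedDeriv p F m)
    (heven : Even p) : ∀ᶠ s in 𝓝[≠] m, F m < F s := by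
  have hK0 : 0 ≤ K / (p + 1).factorial := div_nonneg ((abs_nonneg _).trans (hK 0)) (by positivity)
  obtain ⟨ρ, hρ, hsmall⟩ := exists_pos_forall_small
    (c := iteratedDeriv p F m / p.factorial) (by positivity) hK0
  rw [eventually_nhdsWithin_iff]
  filter_upwards [Metric.ball_mem_nhds m hρ] with s hs hsm
  have hpos' : 0 < |s - m| := abs_pos.2 (sub_ne_zero.2 hsm)
  have h1 := (abs_le.1 (abs_sub_leading_term_le hp hF hK hm s)).1
  have h2 := hsmall |s - m| hpos' (by rwa [← Real.dist_eq])
  have h3 := mul_lt_mul_of_pos_right h2 (pow_pos hpos' p)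
  rw [heven.pow_abs] at h3
  rw [pow_succ', heven.pow_abs] at h1
  have : iteratedDeriv p F m * (s - m) ^ p / p.factorial =
    iteratedDeriv p F m / p.factorial * (s - m) ^ p := by ring
  linarith

/-- A smooth function whose derivatives of order `j` are `O (C^j j!)` and all vanish at a point is
constant. -/
theorem eq_of_forall_iteratedDeriv_eq_zero {F : ℝ → ℝ} (hF : ContDiff ℝ ∞ F) {C : ℝ} (hC : 0 < C)
    (hK : ∀ j, 3 ≤ j → ∀ s, |iteratedDeriv j F s| ≤ C ^ j * j.factorial) {m : ℝ}
    (hm : ∀ j, 1 ≤ j → iteratedDeriv j F m = 0) (s t : ℝ) : F s = F t := by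
  set S : Set ℝ := {m | ∀ j, 1 ≤ j → iteratedDeriv j F m = 0} with hS
  -- With a vanishing Taylor polynomial, the remainder of order `p + 3` is at most `(C |s - m|) ^ (p
  -- + 3)`, since the factorials cancel; it tends to `0` when `C |s - m| < 1/2`. The radius does not
  -- depend on the point, and `S` is clopen.
  have hloc : ∀ m ∈ S, ∀ s ∈ Metric.ball m (1 / (2 * C)), F s = F m := by
    intro m hm s hs
    rw [Metric.mem_ball, Real.dist_eq, lt_div_iff₀ (by positivity)] at hs
    have hb : ∀ p : ℕ, |F s - F m| ≤ (1 / 2) ^ (p + 3) := by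
      intro p
      have h := abs_sub_leading_term_le (p := p + 2) (by omega)
        (by exact_mod_cast contDiff_infty.1 hF (p + 2 + 1))
        (hK (p + 3) (by omega)) (fun j hj _ => hm j hj) s
      rw [hm (p + 2) (by omega)] at h
      rw [show p + 2 + 1 = p + 3 from rfl, mul_div_cancel_right₀ _ (by positivity), ← mul_pow] at h
      simp only [zero_mul, zero_div, sub_zero] at h
      refine h.trans (pow_le_pow_left₀ (by positivity) ?_ _)
      linarith
    have hlim : Tendsto (fun p : ℕ => ((1 : ℝ) / 2) ^ (p + 3)) atTop (𝓝 0) :=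
      (tendsto_pow_atTop_nhds_zero_of_lt_one (by norm_num) (by norm_num)).comp
        (tendsto_add_atTop_nat 3)
    have := ge_of_tendsto' hlim hb
    exact sub_eq_zero.1 (abs_nonpos_iff.1 this)
  have hopen : IsOpen S := by
    rw [Metric.isOpen_iff]
    intro m hm
    refine ⟨1 / (2 * C), by positivity, fun s hs j hj => ?_⟩
    have : F =ᶠ[𝓝 s] fun _ => F m := by
      filter_upwards [Metric.isOpen_ball.mem_nhds hs] with u hu using hloc m hm u hu
    rw [this.iteratedDeriv_eq, iteratedDeriv_const, if_neg (by omega)]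
  have hclosed : IsClosed S := by
    have : S = ⋂ j, ⋂ (_ : 1 ≤ j), {m | iteratedDeriv j F m = 0} := by ext; simp [hS]
    rw [this]
    refine isClosed_iInter fun j => isClosed_iInter fun _ => isClosed_eq ?_ continuous_const
    exact hF.continuous_iteratedDeriv j (by exact_mod_cast le_top)
  have huniv : S = Set.univ := IsClopen.eq_univ ⟨hclosed, hopen⟩ ⟨m, hm⟩
  refine is_const_of_deriv_eq_zero (hF.differentiable (by simp)) (fun x => ?_) s t
  have hx : x ∈ S := huniv ▸ Set.mem_univ x
  simpa using hx 1 le_rfl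

/-! ### The functions `Λ` and `G` -/

theorem integrable_iteratedDeriv_L {E : Type*} [MetricSpace E] [MeasurableSpace E] [BorelSpace E]
    (μ : Measure E) [IsProbabilityMeasure μ] {f : E → unitInterval} (hf : Continuous f)
    (j : ℕ) (s : ℝ) :
    Integrable (fun y => iteratedDeriv j (L (f y)) s) μ := by
  have hm : AEStronglyMeasurable (fun y => iteratedDeriv j (L (f y)) s) μ :=
    ((continuous_iteratedDeriv_L_left j s).measurable.comp hf.measurable).aestronglyMeasurable
  cases j with
  | zero =>
    refine (integrable_const |s|).mono' hm (ae_of_all _ fun y => ?_)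
    simpa using abs_L_le (f y) s
  | succ j =>
    exact (integrable_const _).mono' hm (ae_of_all _ fun y => abs_iteratedDeriv_L_le (f y) j s)

theorem hasDerivAt_integral_iteratedDeriv_L {E : Type*} [MetricSpace E]
    [MeasurableSpace E] [BorelSpace E]
    (μ : Measure E) [IsProbabilityMeasure μ] {f : E → unitInterval} (hf : Continuous f)
    (j : ℕ) (s : ℝ) :
    HasDerivAt (fun t => ∫ y, iteratedDeriv j (L (f y)) t ∂μ)
      (∫ y, iteratedDeriv (j + 1) (L (f y)) s ∂μ) s :=
  (hasDerivAt_integral_of_dominated_loc_of_deriv_le univ_mem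
    (Eventually.of_forall fun t => (integrable_iteratedDeriv_L μ hf j t).1)
    (integrable_iteratedDeriv_L μ hf j s) (integrable_iteratedDeriv_L μ hf (j + 1) s).1
    (ae_of_all _ fun y t _ => abs_iteratedDeriv_L_le (f y) j t) (integrable_const _)
    (ae_of_all _ fun y t _ => hasDerivAt_iteratedDeriv_L (f y) j t)).2

theorem iteratedDeriv_Lam {E : Type*} [MetricSpace E] [MeasurableSpace E] [BorelSpace E]
    (μ : Measure E) [IsProbabilityMeasure μ] {f : E → unitInterval} (hf : Continuous f) (j : ℕ) :
    iteratedDeriv j (Lam μ f) = fun s => ∫ y, iteratedDeriv j (L (f y)) s ∂μ := by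
  induction j with
  | zero => ext s; simp [Lam]
  | succ j ih =>
    rw [iteratedDeriv_succ, ih]
    ext s
    exact (hasDerivAt_integral_iteratedDeriv_L μ hf j s).deriv

theorem contDiff_Lam {E : Type*} [MetricSpace E] [MeasurableSpace E] [BorelSpace E]
    (μ : Measure E) [IsProbabilityMeasure μ] {f : E → unitInterval} (hf : Continuous f) :
    ContDiff ℝ ∞ (Lam μ f) := by
  refine contDiff_of_differentiable_iteratedDeriv (n := ⊤) fun j _ s => ?_
  rw [iteratedDeriv_Lam μ hf]
  exact (hasDerivAt_integral_iteratedDeriv_L μ hf j s).differentiableAt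

theorem abs_iteratedDeriv_Lam_le {E : Type*} [MetricSpace E] [MeasurableSpace E] [BorelSpace E]
    (μ : Measure E) [IsProbabilityMeasure μ] {f : E → unitInterval} (hf : Continuous f)
    (j : ℕ) (s : ℝ) :
    |iteratedDeriv (j + 1) (Lam μ f) s| ≤ 2 ^ j * (j + 1).factorial := by
  rw [iteratedDeriv_Lam μ hf]
  simpa using norm_integral_le_of_norm_le_const (μ := μ)
    (f := fun y => iteratedDeriv (j + 1) (L (f y)) s)
    (ae_of_all _ fun y => abs_iteratedDeriv_L_le (f y) j s)

theorem abs_Lam_le {E : Type*} [MeasurableSpace E] (μ : Measure E) [IsProbabilityMeasure μ]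
    (f : E → unitInterval) (s : ℝ) : |Lam μ f s| ≤ |s| := by
  simpa [Lam] using norm_integral_le_of_norm_le_const (μ := μ) (f := fun y => L (f y) s)
    (ae_of_all _ fun y => abs_L_le (f y) s)

theorem G_eq {E : Type*} [MeasurableSpace E] (μ : Measure E)
    (f : E → unitInterval) (β J s : ℝ) :
    G μ f β J s = β * J / 2 * s ^ 2 - Lam μ f (β * J * s) := rfl

theorem contDiff_G {E : Type*} [MetricSpace E] [MeasurableSpace E] [BorelSpace E]
    (μ : Measure E) [IsProbabilityMeasure μ] {f : E → unitInterval} (hf : Continuous f)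
    (β J : ℝ) : ContDiff ℝ ∞ (G μ f β J) := by
  have h := contDiff_Lam μ hf
  unfold G
  exact (by fun_prop : ContDiff ℝ ∞ fun s : ℝ => β * J / 2 * s ^ 2).sub
    (h.comp (by fun_prop : ContDiff ℝ ∞ fun s : ℝ => β * J * s))

theorem iteratedDeriv_G {E : Type*} [MetricSpace E] [MeasurableSpace E] [BorelSpace E]
    (μ : Measure E) [IsProbabilityMeasure μ] {f : E → unitInterval} (hf : Continuous f)
    (β J : ℝ) (j : ℕ) (s : ℝ) :
    iteratedDeriv j (G μ f β J) s = β * J / 2 * ((2).descFactorial j * s ^ (2 - j)) -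
      (β * J) ^ j * ∫ y, iteratedDeriv j (L (f y)) (β * J * s) ∂μ := by
  have h := contDiff_Lam μ hf
  have h1 : ContDiff ℝ j fun s : ℝ => β * J / 2 * s ^ 2 := by fun_prop
  have h3 : ContDiff ℝ j (Lam μ f) := h.of_le (by exact_mod_cast le_top)
  have h2 : ContDiff ℝ j fun s : ℝ => Lam μ f (β * J * s) := h3.comp (by fun_prop)
  have : G μ f β J = fun s => β * J / 2 * s ^ 2 - Lam μ f (β * J * s) := rfl
  rw [this, iteratedDeriv_fun_sub h1.contDiffAt h2.contDiffAt, iteratedDeriv_const_mul_field,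
    iteratedDeriv_pow, iteratedDeriv_comp_const_mul h3, iteratedDeriv_Lam μ hf]

theorem abs_iteratedDeriv_G_le {E : Type*} [MetricSpace E] [MeasurableSpace E] [BorelSpace E]
    (μ : Measure E) [IsProbabilityMeasure μ] {f : E → unitInterval} (hf : Continuous f)
    {β J : ℝ} (ha : 0 < β * J) {j : ℕ} (hj : 3 ≤ j) (s : ℝ) :
    |iteratedDeriv j (G μ f β J) s| ≤ (2 * (β * J)) ^ j * j.factorial := by
  obtain ⟨k, rfl⟩ := Nat.exists_eq_add_of_le' hj
  rw [iteratedDeriv_G μ hf, Nat.descFactorial_of_lt (by omega)]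
  have h := abs_iteratedDeriv_Lam_le μ hf (k + 2) (β * J * s)
  rw [iteratedDeriv_Lam μ hf] at h
  rw [Nat.cast_zero, zero_mul, mul_zero, zero_sub, abs_neg, abs_mul, abs_pow, abs_of_pos ha,
    mul_pow 2]
  have h2 : (2 : ℝ) ^ (k + 2) ≤ 2 ^ (k + 3) := pow_le_pow_right₀ (by norm_num) (by omega)
  calc (β * J) ^ (k + 3) * |∫ y, iteratedDeriv (k + 3) (L (f y)) (β * J * s) ∂μ|
      ≤ (β * J) ^ (k + 3) * (2 ^ (k + 3) * (k + 3).factorial) := by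
        gcongr
        exact h.trans (by gcongr)
    _ = 2 ^ (k + 3) * (β * J) ^ (k + 3) * (k + 3).factorial := by ring

theorem le_G {E : Type*} [MeasurableSpace E] (μ : Measure E) [IsProbabilityMeasure μ]
    (f : E → unitInterval) {β J : ℝ} (ha : 0 < β * J) (s : ℝ) :
    β * J / 2 * s ^ 2 - β * J * |s| ≤ G μ f β J s := by
  have h := (abs_le.1 (abs_Lam_le μ f (β * J * s))).2
  rw [abs_mul, abs_of_pos ha] at h
  rw [G_eq]
  linarith

theorem G_zero {E : Type*} [MeasurableSpace E] (μ : Measure E)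
    (f : E → unitInterval) (β J : ℝ) : G μ f β J 0 = 0 := by
  simp [G, L_zero]

theorem abs_le_two_of_mem_minimizers {E : Type*} [MeasurableSpace E] (μ : Measure E)
    [IsProbabilityMeasure μ]
    {f : E → unitInterval} {β J : ℝ} (ha : 0 < β * J) {m : ℝ}
    (hm : m ∈ minimizers (G μ f β J)) : |m| ≤ 2 := by
  have h1 := hm 0
  rw [G_zero] at h1
  have h2 := (le_G μ f ha m).trans h1
  rw [← sq_abs] at h2
  by_contra! h
  have : 0 < β * J * |m| * (|m| - 2) := by
    have := abs_nonneg m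
    have h3 : 0 < |m| := by linarith
    have h4 : 0 < |m| - 2 := by linarith
    positivity
  nlinarith

/-- Otherwise `G` would be constant by `eq_of_forall_iteratedDeriv_eq_zero`, whereas `G 0 = 0` and
`G 4 ≥ 4 β J > 0`. -/
theorem exists_iteratedDeriv_G_ne_zero {E : Type*} [MetricSpace E]
    [MeasurableSpace E] [BorelSpace E]
    (μ : Measure E) [IsProbabilityMeasure μ] {f : E → unitInterval} (hf : Continuous f)
    {β J : ℝ} (ha : 0 < β * J) (m : ℝ) :
    {j | 1 ≤ j ∧ iteratedDeriv j (G μ f β J) m ≠ 0}.Nonempty := by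
  by_contra hcon
  have h0 : ∀ j, 1 ≤ j → iteratedDeriv j (G μ f β J) m = 0 := by
    intro j hj
    by_contra h
    exact hcon ⟨j, hj, h⟩
  have h := eq_of_forall_iteratedDeriv_eq_zero (contDiff_G μ hf β J)
    (C := 2 * (β * J)) (by positivity) (fun j hj s => abs_iteratedDeriv_G_le μ hf ha hj s) h0 4 0
  have h4 := le_G μ f ha 4
  rw [h, G_zero] at h4
  norm_num at h4
  linarith

theorem minType_G_pos {E : Type*} [MetricSpace E] [MeasurableSpace E] [BorelSpace E]
    (μ : Measure E) [IsProbabilityMeasure μ] {f : E → unitInterval} (hf : Continuous f)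
    {β J : ℝ} (ha : 0 < β * J) (m : ℝ) : 0 < minType (G μ f β J) m :=
  (Nat.sInf_mem (exists_iteratedDeriv_G_ne_zero μ hf ha m)).1

theorem minStrength_G_ne_zero {E : Type*} [MetricSpace E] [MeasurableSpace E] [BorelSpace E]
    (μ : Measure E) [IsProbabilityMeasure μ] {f : E → unitInterval} (hf : Continuous f)
    {β J : ℝ} (ha : 0 < β * J) (m : ℝ) :
    minStrength (G μ f β J) m ≠ 0 :=
  (Nat.sInf_mem (exists_iteratedDeriv_G_ne_zero μ hf ha m)).2

theorem iteratedDeriv_eq_zero_of_lt_minType {F : ℝ → ℝ} {m : ℝ} {j : ℕ} (hj : 1 ≤ j)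
    (hlt : j < minType F m) : iteratedDeriv j F m = 0 := by
  by_contra h
  exact Nat.notMem_of_lt_sInf hlt ⟨hj, h⟩

/-- A bound for the derivatives of `G` of order at least two, uniform in the measure. -/
theorem abs_iteratedDeriv_G_le' {E : Type*} [MetricSpace E] [MeasurableSpace E] [BorelSpace E]
    (μ : Measure E) [IsProbabilityMeasure μ] {f : E → unitInterval} (hf : Continuous f) {β J : ℝ}
    (ha : 0 < β * J) {p : ℕ} (hp : 0 < p) (s : ℝ) :
    |iteratedDeriv (p + 1) (G μ f β J) s| ≤
      β * J + (2 * (β * J)) ^ (p + 1) * (p + 1).factorial := by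
  -- At order two the quadratic part of `G` still contributes `β J`; from order three on it
  -- vanishes.
  obtain rfl | hp2 := (Nat.succ_le_of_lt hp).eq_or_lt
  · rw [iteratedDeriv_G μ hf]
    have h := abs_iteratedDeriv_Lam_le μ hf 1 (β * J * s)
    rw [iteratedDeriv_Lam μ hf] at h
    refine (abs_sub _ _).trans (add_le_add ?_ ?_)
    · simp [Nat.descFactorial, abs_of_pos ha]
    · rw [abs_mul, abs_pow, abs_of_pos ha, mul_pow]
      norm_num at h ⊢
      nlinarith [sq_nonneg (β * J)]
  · exact (abs_iteratedDeriv_G_le μ hf ha (by omega) s).trans (by linarith)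

theorem even_minType_G_and_minStrength_pos {E : Type*} [MetricSpace E]
    [MeasurableSpace E] [BorelSpace E]
    (μ : Measure E) [IsProbabilityMeasure μ] {f : E → unitInterval} (hf : Continuous f) {β J : ℝ}
    (ha : 0 < β * J) {m : ℝ} (hm : m ∈ minimizers (G μ f β J)) :
    Even (minType (G μ f β J) m) ∧ 0 < minStrength (G μ f β J) m :=
  have hp := minType_G_pos μ hf ha m
  even_and_pos_of_isMin hp ((contDiff_G μ hf β J).of_le (by exact_mod_cast le_top))
    (abs_iteratedDeriv_G_le' μ hf ha hp)
    (fun _ hj hlt => iteratedDeriv_eq_zero_of_lt_minType hj hlt)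
    (minStrength_G_ne_zero μ hf ha m) hm

theorem nonempty_minimizers_G {E : Type*} [MetricSpace E] [MeasurableSpace E] [BorelSpace E]
    (μ : Measure E) [IsProbabilityMeasure μ] {f : E → unitInterval} (hf : Continuous f) {β J : ℝ}
    (ha : 0 < β * J) : (minimizers (G μ f β J)).Nonempty := by
  have hc : Continuous (G μ f β J) := (contDiff_G μ hf β J).continuous
  obtain ⟨m, -, hm⟩ := (isCompact_Icc (a := (-2 : ℝ)) (b := 2)).exists_isMinOn ⟨0, by simp⟩
    hc.continuousOn
  refine ⟨m, fun s => ?_⟩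
  by_cases hs : s ∈ Set.Icc (-2 : ℝ) 2
  · exact hm hs
  · refine (hm (by simp : (0 : ℝ) ∈ Set.Icc (-2 : ℝ) 2)).trans ?_
    rw [G_zero]
    refine le_trans ?_ (le_G μ f ha s)
    have h2 : 2 ≤ |s| := by
      by_contra! h
      exact hs ⟨(abs_lt.1 h).1.le, (abs_lt.1 h).2.le⟩
    rw [← sq_abs]
    nlinarith [mul_nonneg ha.le (mul_nonneg (abs_nonneg s) (sub_nonneg.2 h2))]

/-- An infinite set of minimizers in `[-2, 2]` would accumulate at a point that is again a
minimizer, because the set is closed. This contradicts strict minimality near a minimum of finite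
type. -/
theorem finite_minimizers_G {E : Type*} [MetricSpace E] [MeasurableSpace E] [BorelSpace E]
    (μ : Measure E) [IsProbabilityMeasure μ] {f : E → unitInterval} (hf : Continuous f) {β J : ℝ}
    (ha : 0 < β * J) : (minimizers (G μ f β J)).Finite := by
  have hc : Continuous (G μ f β J) := (contDiff_G μ hf β J).continuous
  by_contra hinf
  obtain ⟨m, -, hm⟩ := Set.Infinite.exists_accPt_of_subset_isCompact hinf
    (isCompact_Icc (a := (-2 : ℝ)) (b := 2))
    (fun m hm => abs_le.1 (abs_le_two_of_mem_minimizers μ ha hm))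
  have hclosed : IsClosed (minimizers (G μ f β J)) := by
    have : minimizers (G μ f β J) = ⋂ s, {m | G μ f β J m ≤ G μ f β J s} := by
      ext; simp [minimizers]
    rw [this]
    exact isClosed_iInter fun s => isClosed_le hc continuous_const
  have hmem : m ∈ minimizers (G μ f β J) := hclosed.closure_subset hm.clusterPt.mem_closure
  have hp := minType_G_pos μ hf ha m
  obtain ⟨heven, hpos⟩ := even_minType_G_and_minStrength_pos μ hf ha hmem
  have hlt := eventually_lt_of_pos hp ((contDiff_G μ hf β J).of_le (by exact_mod_cast le_top))
    (abs_iteratedDeriv_G_le' μ hf ha hp)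
    (fun _ hj hlt => iteratedDeriv_eq_zero_of_lt_minType hj hlt) hpos heven
  obtain ⟨s, hs1, hs2⟩ := ((accPt_iff_frequently_nhdsNE.1 hm).and_eventually hlt).exists
  exact absurd (hs1 m) (not_le.2 hs2)

/-! ### Empirical measures of orbits and unique ergodicity -/

/-- The empirical measure of `T x, …, T^n x`. -/
noncomputable def empiricalMeasure {E : Type*} [MeasurableSpace E] (T : E → E) (x : E) (n : ℕ) :
    Measure E :=
  (n : ENNReal)⁻¹ • ∑ k ∈ Finset.Icc 1 n, Measure.dirac (T^[k] x)

theorem isProbabilityMeasure_empiricalMeasure {E : Type*} [MeasurableSpace E] (T : E → E) (x : E)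
    {n : ℕ} (hn : n ≠ 0) : IsProbabilityMeasure (empiricalMeasure T x n) := by
  constructor
  simp only [empiricalMeasure, Measure.smul_apply, Measure.coe_finsetSum, Finset.sum_apply,
    measure_univ, smul_eq_mul]
  simp only [Finset.sum_const, Nat.card_Icc, add_tsub_cancel_right, nsmul_eq_mul, mul_one]
  exact ENNReal.inv_mul_cancel (by exact_mod_cast hn) (ENNReal.natCast_ne_top n)

theorem integral_empiricalMeasure {E : Type*} [MeasurableSpace E] [MeasurableSingletonClass E]
    (T : E → E) (x : E) (n : ℕ) (u : E → ℝ) :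
    ∫ y, u y ∂(empiricalMeasure T x n) = 1 / n * ∑ k ∈ Finset.Icc 1 n, u (T^[k] x) := by
  rw [empiricalMeasure, integral_smul_measure,
    integral_finsetSum_measure fun k _ => integrable_dirac (by simp)]
  simp

/-- This identity transfers every estimate proved for an arbitrary probability measure to `Gn`, with
constants independent of `n`. -/
theorem Gn_eq_G {E : Type*} [MeasurableSpace E] [MeasurableSingletonClass E] (T : E → E)
    (f : E → unitInterval) (β J : ℝ) (x : E) (n : ℕ) :
    Gn T f β J x n = G (empiricalMeasure T x n) f β J := by
  ext s
  rw [Gn, G, integral_empiricalMeasure]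

/-- The difference telescopes along the orbit to two boundary terms divided by `n`. Hence limits of
empirical measures are invariant. -/
theorem abs_integral_comp_sub_integral_empiricalMeasure_le {E : Type*} [MeasurableSpace E]
    [MeasurableSingletonClass E] (T : E → E) (x : E) {n : ℕ} (hn : n ≠ 0) {u : E → ℝ} {C : ℝ}
    (hu : ∀ y, |u y| ≤ C) :
    |∫ y, u (T y) ∂(empiricalMeasure T x n) - ∫ y, u y ∂(empiricalMeasure T x n)| ≤
      2 * C / n := by
  have h : ∑ k ∈ Finset.Icc 1 n, u (T (T^[k] x)) - ∑ k ∈ Finset.Icc 1 n, u (T^[k] x) =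
      u (T^[n + 1] x) - u (T^[1] x) := by
    rw [← Finset.sum_sub_distrib]
    have := Finset.sum_Ico_sub (fun k => u (T^[k] x)) (show 1 ≤ n + 1 by omega)
    rw [← this]
    refine Finset.sum_congr rfl fun k _ => ?_
    rw [Function.iterate_succ_apply']
  rw [integral_empiricalMeasure, integral_empiricalMeasure, ← mul_sub, h,
    abs_mul, abs_of_nonneg (by positivity : (0 : ℝ) ≤ 1 / n), one_div, inv_mul_eq_div]
  gcongr
  refine (abs_sub _ _).trans ?_
  linarith [hu (T^[n + 1] x), hu (T^[1] x)]

/-- For a uniquely ergodic map, the averages of a continuous function along every orbit converge. -/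
theorem UniquelyErgodic.tendsto_integral_empiricalMeasure {E : Type*} [MetricSpace E]
    [CompactSpace E] [MeasurableSpace E] [BorelSpace E] {μ : Measure E} [IsProbabilityMeasure μ]
    {T : E → E} (hT : Continuous T) (hμ : UniquelyErgodic T μ) (x : E) {u : E → ℝ}
    (hu : Continuous u) :
    Tendsto (fun n => ∫ y, u y ∂(empiricalMeasure T x n)) atTop (𝓝 (∫ y, u y ∂μ)) := by
  -- The shift avoids `n = 0`, where the empirical measure is the zero measure and not a probability
  -- measure.
  rw [← tendsto_add_atTop_iff_nat 1]
  set P : ℕ → ProbabilityMeasure E := fun n =>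
    ⟨empiricalMeasure T x (n + 1), isProbabilityMeasure_empiricalMeasure T x n.succ_ne_zero⟩
    with hP
  set μ' : ProbabilityMeasure E := ⟨μ, inferInstance⟩ with hμ'
  suffices h : Tendsto P atTop (𝓝 μ') from
    ProbabilityMeasure.tendsto_iff_forall_integral_tendsto.1 h
      (BoundedContinuousFunction.mkOfCompact ⟨u, hu⟩)
  -- The space of probability measures on a compact metric space is compact, so along each
  -- ultrafilter there is a limit `ν`. It is invariant, hence equal to `μ` by unique ergodicity.
  rw [tendsto_iff_ultrafilter]
  intro U hU
  obtain ⟨ν, hν⟩ : ∃ ν, (U.map P : Filter (ProbabilityMeasure E)) ≤ 𝓝 ν :=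
    ⟨_, (U.map P).le_nhds_lim⟩
  have hν' := ProbabilityMeasure.tendsto_iff_forall_integral_tendsto.1
    (show Tendsto P U (𝓝 ν) from hν)
  have hinv : (ν : Measure E).map T = ν := by
    have := Measure.isProbabilityMeasure_map (μ := (ν : Measure E)) hT.aemeasurable
    refine ext_of_forall_integral_eq_of_IsFiniteMeasure fun v => ?_
    rw [integral_map hT.aemeasurable v.continuous.aestronglyMeasurable]
    have h1 := hν' (v.compContinuous ⟨T, hT⟩)
    have h2 := hν' v
    refine tendsto_nhds_unique h1 ?_
    have h3 : Tendsto (fun n => ∫ y, v (T y) ∂(P n : Measure E) - ∫ y, v y ∂(P n : Measure E))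
        U (𝓝 0) := by
      refine squeeze_zero_norm' (a := fun n : ℕ => 2 * ‖v‖ / ((n + 1 : ℕ) : ℝ))
        (Eventually.of_forall fun n => ?_) (Tendsto.mono_left ?_ hU)
      · exact abs_integral_comp_sub_integral_empiricalMeasure_le
          T x n.succ_ne_zero v.norm_coe_le_norm
      · exact (tendsto_const_div_atTop_nhds_zero_nat _).comp (tendsto_add_atTop_nat 1)
    simpa using h3.add h2
  have : ν = μ' := Subtype.ext (hμ.2 ν inferInstance ⟨hT.measurable, hinv⟩)
  rw [← this]
  exact hν

/-! ### Laplace's method near a single minimum -/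

theorem pow_le_one_add_pow {t : ℝ} (ht : 0 ≤ t) {j p : ℕ} (h : j ≤ p) : t ^ j ≤ 1 + t ^ p := by
  rcases le_total t 1 with h1 | h1
  · have := pow_le_one₀ (n := j) ht h1
    have := pow_nonneg ht p
    linarith
  · have := pow_le_pow_right₀ h1 h
    linarith

section Rescaling

variable {p n : ℕ}

theorem rpow_inv_pow_eq (hp : 0 < p) : ((n : ℝ) ^ (1 / (p : ℝ))) ^ p = n := by
  rw [one_div]
  exact Real.rpow_inv_natCast_pow (Nat.cast_nonneg n) hp.ne'

/-- Under `s = m + v / n^(1/p)` the Taylor term of order `j` acquires the factor `n^(1 - j/p)`: it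
is `1` at `j = p`, and for `j < p` the coefficient has to compensate its growth. -/
theorem mul_div_rpow_pow (hn : 0 < n) (c v : ℝ) (j : ℕ) :
    n * (c * (v / (n : ℝ) ^ (1 / (p : ℝ))) ^ j / j.factorial) =
      (n : ℝ) ^ (1 - (j : ℝ) / p) * c * v ^ j / j.factorial := by
  have hn' : (0 : ℝ) < n := by exact_mod_cast hn
  rw [Real.rpow_sub hn', Real.rpow_one, div_pow, ← Real.rpow_natCast (_ ^ _),
    ← Real.rpow_mul hn'.le,
    one_div_mul_eq_div]
  ring

theorem mul_abs_div_rpow_pow_succ (hp : 0 < p) (hn : 0 < n) (K v : ℝ) :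
    n * (K * |v / (n : ℝ) ^ (1 / (p : ℝ))| ^ (p + 1)) =
      K * (|v| / (n : ℝ) ^ (1 / (p : ℝ))) * |v| ^ p := by
  have hn' : (0 : ℝ) < n := by exact_mod_cast hn
  have hr : (0 : ℝ) < (n : ℝ) ^ (1 / (p : ℝ)) := Real.rpow_pos_of_pos hn' _
  rw [abs_div, abs_of_pos hr, pow_succ, div_pow, rpow_inv_pow_eq hp]
  field_simp

end Rescaling

theorem tendsto_rpow_one_div_atTop {p : ℕ} (hp : 0 < p) :
    Tendsto (fun n : ℕ => (n : ℝ) ^ (1 / (p : ℝ))) atTop atTop :=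
  (tendsto_rpow_atTop (by positivity)).comp tendsto_natCast_atTop_atTop

/-- Laplace's method for a sequence of functions with a minimum of type `p`, whose Taylor
coefficients of order `j` at `m` are `o (n^(j/p - 1))` for `j < p`. -/
theorem tendsto_local_laplace {g : ℕ → ℝ → ℝ} (hg : ∀ n, Continuous (g n)) {p : ℕ} (hp : 0 < p)
    (heven : Even p) {m K lam : ℝ} (hK : 0 ≤ K) (hlam : 0 < lam) {c : ℕ → ℕ → ℝ}
    (hT : ∀ᶠ n in atTop, ∀ s, |g n s - g n m -
      ∑ j ∈ Finset.Icc 1 p, c n j * (s - m) ^ j / j.factorial| ≤ K * |s - m| ^ (p + 1))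
    (hc : ∀ j ∈ Finset.Icc 1 p, Tendsto (fun n : ℕ => (n : ℝ) ^ (1 - (j : ℝ) / p) * c n j) atTop
      (𝓝 (if j = p then lam else 0)))
    {δ : ℝ} (hδ : 0 < δ) (hδK : K * δ ≤ lam / p.factorial / 4) (h : ℝ →ᵇ ℝ) :
    Tendsto (fun n : ℕ => (n : ℝ) ^ (1 / (p : ℝ)) * Real.exp (n * g n m) *
        ∫ s in Metric.ball m δ, h s * Real.exp (-(n * g n s))) atTop
      (𝓝 (h m * ∫ v, Real.exp (-(lam * v ^ p / p.factorial)))) := by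
  set r : ℕ → ℝ := fun n => (n : ℝ) ^ (1 / (p : ℝ)) with hr
  set lam' := lam / p.factorial with hlam'
  have hlam'0 : 0 < lam' := by positivity
  have hrlim : Tendsto r atTop atTop := tendsto_rpow_one_div_atTop hp
  have hp2 : 2 ≤ p := by obtain ⟨k, rfl⟩ := heven; omega
  have hp0 : (0 : ℝ) < p := by exact_mod_cast hp
  set Φ : ℕ → ℝ → ℝ := fun n v => (Metric.ball m δ).indicator
    (fun s => h s * Real.exp (-(n * (g n s - g n m)))) (m + v / r n) with hΦ
  have hexp : ∀ᶠ n : ℕ in atTop, ∀ v, |n * (g n (m + v / r n) - g n m) -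
      ∑ j ∈ Finset.Icc 1 p, (n : ℝ) ^ (1 - (j : ℝ) / p) * c n j * v ^ j / j.factorial| ≤
        K * (|v| / r n) * |v| ^ p := by
    filter_upwards [hT, eventually_gt_atTop 0] with n hn hn0 v
    have hn0' : (0 : ℝ) < n := by exact_mod_cast hn0
    have h1 := mul_le_mul_of_nonneg_left (hn (m + v / r n)) hn0'.le
    rw [add_sub_cancel_left, mul_abs_div_rpow_pow_succ hp hn0] at h1
    rw [← abs_of_pos hn0', ← abs_mul, mul_sub, Finset.mul_sum, abs_of_pos hn0'] at h1
    rwa [Finset.sum_congr rfl fun j _ => mul_div_rpow_pow hn0 (c n j) v j] at h1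
  have hchange : ∀ᶠ n : ℕ in atTop, (n : ℝ) ^ (1 / (p : ℝ)) * Real.exp (n * g n m) *
      ∫ s in Metric.ball m δ, h s * Real.exp (-(n * g n s)) = ∫ v, Φ n v := by
    filter_upwards [eventually_gt_atTop 0] with n hn
    have hrn : 0 < r n := Real.rpow_pos_of_pos (by exact_mod_cast hn) _
    set F : ℝ → ℝ := (Metric.ball m δ).indicator
      (fun s => h s * Real.exp (-(n * (g n s - g n m)))) with hF
    have h1 : ∫ v, F (m + v / r n) = r n * ∫ s, F s := by
      rw [Measure.integral_comp_div (fun w => F (m + w)) (r n), integral_add_left_eq_self,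
        abs_of_pos hrn, smul_eq_mul]
    rw [hΦ, h1, hF, integral_indicator Metric.isOpen_ball.measurableSet, mul_assoc,
      ← integral_const_mul]
    congr 1
    refine integral_congr_ae (ae_of_all _ fun s => ?_)
    simp only
    rw [mul_left_comm, ← Real.exp_add]
    congr 2
    ring
  have hmeas : ∀ n, AEStronglyMeasurable (Φ n) volume := by
    intro n
    refine Measurable.aestronglyMeasurable ?_
    refine (Measurable.indicator ?_ Metric.isOpen_ball.measurableSet).comp (by fun_prop)
    have := (hg n).measurable
    have := h.continuous.measurable
    fun_prop
  refine Tendsto.congr' (hchange.mono fun n hn => hn.symm) ?_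
  rw [← integral_const_mul]
  -- Inside the ball the exponent is at most `-lam' v^p`, plus `lam'/4 * v^p` from the remainder (by
  -- `hδK`), plus `lam'/4 * (1 + v^p)` from the error in the coefficients. With `v² ≤ 1 + v^p` this
  -- is at most `3/4 * lam' - lam'/2 * v²`, a Gaussian majorant.
  refine tendsto_integral_filter_of_dominated_convergence
    (fun v => ‖h‖ * (Real.exp (3 / 4 * lam') * Real.exp (-(lam' / 2) * v ^ 2)))
    (Eventually.of_forall hmeas) ?_ ?_ ?_
  -- There are `p` coefficients, so a tolerance of `lam'/4/p` for each adds up to `lam'/4`.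
  · have hη : 0 < lam' / 4 / p := by positivity
    have hclose : ∀ᶠ n : ℕ in atTop, ∀ j ∈ Finset.Icc 1 p,
        |(n : ℝ) ^ (1 - (j : ℝ) / p) * c n j - if j = p then lam else 0| < lam' / 4 / p := by
      rw [Filter.eventually_all_finset]
      intro j hj
      simpa only [Real.dist_eq] using (Metric.tendsto_nhds.1 (hc j hj)) _ hη
    filter_upwards [hexp, hclose, eventually_gt_atTop 0] with n hn hcl hn0
    have hrn : 0 < r n := Real.rpow_pos_of_pos (by exact_mod_cast hn0) _
    refine ae_of_all _ fun v => ?_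
    by_cases hv : m + v / r n ∈ Metric.ball m δ
    swap
    · simp only [hΦ, Set.indicator_of_notMem hv, norm_zero]
      positivity
    simp only [hΦ, Set.indicator_of_mem hv, norm_mul, Real.norm_eq_abs (Real.exp _), Real.abs_exp]
    rw [← Real.exp_add]
    refine mul_le_mul (h.norm_coe_le_norm _) (Real.exp_le_exp.2 ?_) (Real.exp_pos _).le
      (norm_nonneg _)
    have hvδ : |v| / r n < δ := by
      rw [Metric.mem_ball, Real.dist_eq, add_sub_cancel_left, abs_div, abs_of_pos hrn] at hv
      exact hv
    have hvp : (0 : ℝ) ≤ v ^ p := heven.pow_nonneg v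
    have hrem : K * (|v| / r n) * |v| ^ p ≤ lam' / 4 * v ^ p := by
      rw [heven.pow_abs]
      exact mul_le_mul_of_nonneg_right
        ((mul_le_mul_of_nonneg_left hvδ.le hK).trans hδK) hvp
    have hsum : |∑ j ∈ Finset.Icc 1 p,
        ((n : ℝ) ^ (1 - (j : ℝ) / p) * c n j * v ^ j / j.factorial -
          (if j = p then lam else 0) * v ^ j / j.factorial)| ≤ lam' / 4 * (1 + v ^ p) := by
      refine (Finset.abs_sum_le_sum_abs _ _).trans ((Finset.sum_le_card_nsmul _ _
        (lam' / 4 / p * (1 + v ^ p)) fun j hj => ?_).trans_eq ?_)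
      · rw [← sub_div, ← sub_mul, abs_div, abs_mul, Nat.abs_cast, abs_pow]
        have hf1 : (1 : ℝ) ≤ j.factorial := by
          exact_mod_cast Nat.one_le_iff_ne_zero.2 j.factorial_ne_zero
        refine (div_le_self (by positivity) hf1).trans ?_
        refine mul_le_mul (hcl j hj).le ?_ (by positivity) hη.le
        rw [← heven.pow_abs]
        exact pow_le_one_add_pow (abs_nonneg v) (Finset.mem_Icc.1 hj).2
      · rw [Nat.card_Icc, add_tsub_cancel_right, nsmul_eq_mul]
        field_simp
    rw [Finset.sum_sub_distrib] at hsum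
    have hmain : ∑ j ∈ Finset.Icc 1 p, (if j = p then lam else 0) * v ^ j / j.factorial =
        lam' * v ^ p := by
      rw [Finset.sum_eq_single_of_mem p (Finset.mem_Icc.2 ⟨hp, le_rfl⟩)
        fun j _ hj => by simp [hj], if_pos rfl, hlam']
      ring
    rw [hmain] at hsum
    have hsq : v ^ 2 ≤ 1 + v ^ p := by
      have := pow_le_one_add_pow (abs_nonneg v) hp2
      rwa [heven.pow_abs, sq_abs] at this
    have h1 := (abs_le.1 (hn v)).1
    have h2 := (abs_le.1 hsum).1
    nlinarith
  · exact ((integrable_exp_neg_mul_sq (by positivity)).const_mul _).const_mul _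
  · refine ae_of_all _ fun v => ?_
    have hs : Tendsto (fun n => m + v / r n) atTop (𝓝 m) := by
      simpa using tendsto_const_nhds.add (hrlim.const_div_atTop v)
    have hev : ∀ᶠ n in atTop, m + v / r n ∈ Metric.ball m δ :=
      hs (Metric.ball_mem_nhds m hδ)
    have hE : Tendsto (fun n : ℕ => n * (g n (m + v / r n) - g n m)) atTop
        (𝓝 (lam * v ^ p / p.factorial)) := by
      have hS : Tendsto (fun n : ℕ => ∑ j ∈ Finset.Icc 1 p,
          (n : ℝ) ^ (1 - (j : ℝ) / p) * c n j * v ^ j / j.factorial) atTop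
          (𝓝 (lam * v ^ p / p.factorial)) := by
        have := tendsto_finsetSum (Finset.Icc 1 p) fun j hj =>
          ((hc j hj).mul_const (v ^ j)).div_const (j.factorial : ℝ)
        rwa [Finset.sum_eq_single_of_mem p (Finset.mem_Icc.2 ⟨hp, le_rfl⟩)
          fun j _ hj => by simp [hj], if_pos rfl] at this
      have hR : Tendsto (fun n : ℕ => K * (|v| / r n) * |v| ^ p) atTop (𝓝 0) := by
        simpa using ((hrlim.const_div_atTop |v|).const_mul K).mul_const (|v| ^ p)
      have := squeeze_zero_norm' (hexp.mono fun n hn => (Real.norm_eq_abs _).trans_le (hn v)) hR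
      simpa using this.add hS
    refine Tendsto.congr' (hev.mono fun n hn => (Set.indicator_of_mem hn _).symm) ?_
    exact ((h.continuous.tendsto m).comp hs).mul ((Real.continuous_exp.tendsto _).comp hE.neg)

/-! ### Localization of the Laplace integral at the minima of `G` -/

theorem integrable_exp_neg_mul_pow {p : ℕ} (hp : 2 ≤ p) (heven : Even p) {c : ℝ} (hc : 0 < c) :
    Integrable fun s : ℝ => Real.exp (-(c * s ^ p)) := by
  refine ((integrable_exp_neg_mul_sq hc).const_mul (Real.exp c)).mono'
    (by fun_prop) (ae_of_all _ fun s => ?_)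
  rw [Real.norm_eq_abs, Real.abs_exp, ← Real.exp_add]
  refine Real.exp_le_exp.2 ?_
  have h := pow_le_one_add_pow (abs_nonneg s) hp
  rw [heven.pow_abs, sq_abs] at h
  nlinarith

/-- The substitution `s ↦ lam^(1/p) s` moves the strength from the prefactor of `weight` into the
exponent, where `tendsto_local_laplace` produces it. -/
theorem rpow_mul_integral_exp_neg_pow {p : ℕ} (hp : 0 < p) {lam : ℝ} (hlam : 0 < lam) :
    lam ^ (-1 / (p : ℝ)) * ∫ s : ℝ, Real.exp (-(s ^ p / p.factorial)) =
      ∫ s : ℝ, Real.exp (-(lam * s ^ p / p.factorial)) := by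
  have hr : 0 < lam ^ (1 / (p : ℝ)) := Real.rpow_pos_of_pos hlam _
  have h := Measure.integral_comp_mul_left
    (fun s : ℝ => Real.exp (-(s ^ p / p.factorial))) (lam ^ (1 / (p : ℝ)))
  have hpow : (lam ^ (1 / (p : ℝ))) ^ p = lam := by
    rw [one_div]; exact Real.rpow_inv_natCast_pow hlam.le hp.ne'
  simp only [mul_pow, hpow] at h
  rw [h, abs_of_pos (inv_pos.2 hr), ← Real.rpow_neg hlam.le, smul_eq_mul, neg_div]

/-- The Lipschitz constant is the same for every probability measure. This equicontinuity upgrades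
pointwise convergence of `Gn` to bounds uniform on compact sets. -/
theorem abs_Lam_sub_le {E : Type*} [MetricSpace E] [MeasurableSpace E] [BorelSpace E]
    (μ : Measure E) [IsProbabilityMeasure μ] {f : E → unitInterval} (hf : Continuous f) (s t : ℝ) :
    |Lam μ f s - Lam μ f t| ≤ |s - t| := by
  have hd : Differentiable ℝ (Lam μ f) := (contDiff_Lam μ hf).differentiable (by simp)
  have h := Convex.norm_image_sub_le_of_norm_deriv_le (f := Lam μ f) (C := 1) (s := Set.univ)
    (fun u _ => hd u) (fun u _ => ?_) convex_univ (Set.mem_univ t) (Set.mem_univ s)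
  · simpa using h
  · simpa using abs_iteratedDeriv_Lam_le μ hf 0 u

theorem quadratic_le_G {E : Type*} [MeasurableSpace E] (μ : Measure E) [IsProbabilityMeasure μ]
    (f : E → unitInterval) {β J : ℝ} (ha : 0 < β * J) (s : ℝ) :
    β * J / 4 * s ^ 2 - β * J ≤ G μ f β J s := by
  refine le_trans ?_ (le_G μ f ha s)
  rw [← sq_abs s]
  nlinarith [mul_nonneg ha.le (sq_nonneg (|s| / 2 - 1))]

section

variable {E : Type*} [MetricSpace E] [MeasurableSpace E] [BorelSpace E]
  {μ : Measure E} [IsProbabilityMeasure μ] {T : E → E} {f : E → unitInterval} {β J : ℝ} {x : E}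

theorem tendsto_Lam_empiricalMeasure [CompactSpace E] (hT : Continuous T) (hμ : UniquelyErgodic T μ)
    (hf : Continuous f) (x : E) (t : ℝ) :
    Tendsto (fun n => Lam (empiricalMeasure T x n) f t) atTop (𝓝 (Lam μ f t)) :=
  hμ.tendsto_integral_empiricalMeasure hT x ((continuous_L_left t).comp hf)

theorem tendsto_Gn [CompactSpace E] (hT : Continuous T)
    (hμ : UniquelyErgodic T μ) (hf : Continuous f)
    (β J : ℝ) (x : E) (s : ℝ) :
    Tendsto (fun n => Gn T f β J x n s) atTop (𝓝 (G μ f β J s)) := by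
  simp only [Gn_eq_G, G_eq]
  exact (tendsto_Lam_empiricalMeasure hT hμ hf x _).const_sub _

theorem contDiff_Gn (hf : Continuous f) {n : ℕ} (hn : n ≠ 0) : ContDiff ℝ ∞ (Gn T f β J x n) := by
  have := isProbabilityMeasure_empiricalMeasure T x hn
  rw [Gn_eq_G]
  exact contDiff_G _ hf β J

theorem quadratic_le_Gn (ha : 0 < β * J) {n : ℕ} (hn : n ≠ 0) (s : ℝ) :
    β * J / 4 * s ^ 2 - β * J ≤ Gn T f β J x n s := by
  have := isProbabilityMeasure_empiricalMeasure T x hn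
  rw [Gn_eq_G]
  exact quadratic_le_G _ f ha s

/-- On a compact set where `G > γ`, the functions `G_n` are eventually bounded below by some
`γ + ε`. -/
theorem exists_eventually_le_Gn_of_isCompact [CompactSpace E] (hT : Continuous T)
    (hμ : UniquelyErgodic T μ)
    (hf : Continuous f) (x : E) {γ : ℝ} {K : Set ℝ} (hK : IsCompact K)
    (hγ : ∀ s ∈ K, γ < G μ f β J s) :
    ∃ ε > 0, ∀ᶠ n in atTop, ∀ s ∈ K, γ + ε ≤ Gn T f β J x n s := by
  -- The property is inherited by subsets and finite unions, so a neighbourhood of each point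
  -- suffices. There the oscillation of `Gn` is below `ε`, uniformly in `n ≥ 1`, and with `ε` a
  -- third of the gap a margin `ε` remains.
  refine hK.induction_on (p := fun S => ∃ ε > 0, ∀ᶠ n in atTop, ∀ s ∈ S, γ + ε ≤ Gn T f β J x n s)
    ⟨1, one_pos, by simp⟩ ?_ ?_ ?_
  · rintro S S' hS ⟨ε, hε, h⟩
    exact ⟨ε, hε, h.mono fun n hn s hs => hn s (hS hs)⟩
  · rintro S S' ⟨ε, hε, h⟩ ⟨ε', hε', h'⟩
    refine ⟨min ε ε', lt_min hε hε', ?_⟩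
    filter_upwards [h, h'] with n hn hn' s hs
    rcases hs with hs | hs
    · exact (add_le_add_right (min_le_left _ _) γ).trans (hn s hs)
    · exact (add_le_add_right (min_le_right _ _) γ).trans (hn' s hs)
  · intro s₀ hs₀
    set ε := (G μ f β J s₀ - γ) / 3 with hε
    have hε0 : 0 < ε := by have := hγ s₀ hs₀; rw [hε]; linarith
    have hcont : Tendsto (fun s => |β * J / 2 * s ^ 2 - β * J / 2 * s₀ ^ 2| +
      |β * J * s - β * J * s₀|)
        (𝓝 s₀) (𝓝 0) := by
      have : Continuous fun s =>
          |β * J / 2 * s ^ 2 - β * J / 2 * s₀ ^ 2| + |β * J * s - β * J * s₀| := by fun_prop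
      simpa using this.tendsto s₀
    refine ⟨_, mem_nhdsWithin_of_mem_nhds (hcont.eventually_lt_const hε0), ε, hε0, ?_⟩
    have h1 : ∀ᶠ n in atTop, G μ f β J s₀ - ε < Gn T f β J x n s₀ :=
      (tendsto_Gn hT hμ hf β J x s₀).eventually_const_lt (by linarith)
    filter_upwards [h1, eventually_ne_atTop 0] with n hn hn0 s hs
    have := isProbabilityMeasure_empiricalMeasure T x hn0
    have h2 := abs_Lam_sub_le (empiricalMeasure T x n) hf (β * J * s) (β * J * s₀)
    rw [Gn_eq_G, G_eq (empiricalMeasure T x n)] at hn ⊢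
    have h3 := (abs_le.1 h2).2
    have h4 := neg_abs_le (β * J / 2 * s ^ 2 - β * J / 2 * s₀ ^ 2)
    have h5 : |β * J / 2 * s ^ 2 - β * J / 2 * s₀ ^ 2| + |β * J * s - β * J * s₀| < ε := hs
    linarith

/-- Compactness handles `[-4, 4]` minus `U`. Beyond it the quadratic bound gives `Gn ≥ 3 β J`, while
`G m ≤ G 0 = 0`, so a margin `β J` is available. -/
theorem exists_eventually_le_Gn [CompactSpace E] (hT : Continuous T) (hμ : UniquelyErgodic T μ)
    (hf : Continuous f) (ha : 0 < β * J) (x : E) {U : Set ℝ} (hU : IsOpen U) {m : ℝ}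
    (hm : m ∈ minimizers (G μ f β J)) (hMU : minimizers (G μ f β J) ⊆ U) :
    ∃ ε > 0, ∀ᶠ n in atTop, ∀ s ∉ U, G μ f β J m + ε ≤ Gn T f β J x n s := by
  obtain ⟨ε, hε, h⟩ := exists_eventually_le_Gn_of_isCompact (γ := G μ f β J m)
    (K := Set.Icc (-4) 4 ∩ Uᶜ) hT hμ hf x (isCompact_Icc.inter_right hU.isClosed_compl) (by
      rintro s ⟨-, hs⟩
      refine lt_of_le_of_ne (hm s) fun heq => hs (hMU fun t => ?_)
      rw [← heq]
      exact hm t)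
  refine ⟨min ε (β * J), lt_min hε ha, ?_⟩
  filter_upwards [h, eventually_ne_atTop 0] with n hn hn0 s hs
  by_cases hs4 : s ∈ Set.Icc (-4 : ℝ) 4
  · exact (add_le_add_right (min_le_left _ _) _).trans (hn s ⟨hs4, hs⟩)
  · have h4 : 4 ≤ |s| := by
      by_contra! h
      exact hs4 ⟨(abs_lt.1 h).1.le, (abs_lt.1 h).2.le⟩
    have h0 := hm 0
    rw [G_zero] at h0
    have h1 := quadratic_le_Gn (T := T) (f := f) (x := x) ha hn0 s
    have h2 : 16 ≤ s ^ 2 := by rw [← sq_abs]; nlinarith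
    have h3 := min_le_right ε (β * J)
    nlinarith

/-- A Gaussian majorant independent of `n`: one factor `exp (-Gn)` out of `n` is enough to make the
integral over an unbounded set finite. -/
theorem exp_neg_mul_Gn_le (ha : 0 < β * J) {n : ℕ} (hn : n ≠ 0) (s : ℝ) :
    Real.exp (-Gn T f β J x n s) ≤ Real.exp (β * J) * Real.exp (-(β * J / 4) * s ^ 2) := by
  rw [← Real.exp_add]
  refine Real.exp_le_exp.2 ?_
  have := quadratic_le_Gn (T := T) (f := f) (x := x) ha hn s
  linarith

theorem integrable_mul_exp_neg_Gn (hf : Continuous f) (ha : 0 < β * J) {n : ℕ} (hn : n ≠ 0)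
    (h : ℝ →ᵇ ℝ) : Integrable fun s => h s * Real.exp (-(n * Gn T f β J x n s)) := by
  have hn' : (0 : ℝ) < n := by exact_mod_cast Nat.pos_of_ne_zero hn
  have hc := (contDiff_Gn (T := T) (β := β) (J := J) (x := x) hf hn).continuous
  refine ((integrable_exp_neg_mul_sq (by positivity : 0 < n * (β * J / 4))).const_mul
    (‖h‖ * Real.exp (n * (β * J)))).mono' (by fun_prop) (ae_of_all _ fun s => ?_)
  rw [norm_mul, mul_assoc, Real.norm_eq_abs (Real.exp _), Real.abs_exp, ← Real.exp_add]
  refine mul_le_mul (h.norm_coe_le_norm s) (Real.exp_le_exp.2 ?_) (Real.exp_pos _).le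
    (norm_nonneg _)
  have := mul_le_mul_of_nonneg_left (quadratic_le_Gn (T := T) (f := f) (x := x) ha hn s) hn'.le
  linarith

theorem weight_eq (hf : Continuous f) (ha : 0 < β * J) {m : ℝ}
    (hm : m ∈ minimizers (G μ f β J)) (n : ℕ) :
    weight μ T f β J x m n = (n : ℝ) ^ (-1 / (minType (G μ f β J) m : ℝ)) *
      Real.exp (-(n * Gn T f β J x n m)) * ∫ s : ℝ, Real.exp (-(minStrength (G μ f β J) m *
        s ^ minType (G μ f β J) m / (minType (G μ f β J) m).factorial)) := by
  rw [weight, mul_assoc _ (_ ^ _), rpow_mul_integral_exp_neg_pow (minType_G_pos μ hf ha m)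
    (even_minType_G_and_minStrength_pos μ hf ha hm).2]

theorem integral_exp_neg_minStrength_pos (hf : Continuous f) (ha : 0 < β * J) {m : ℝ}
    (hm : m ∈ minimizers (G μ f β J)) :
    0 < ∫ s : ℝ, Real.exp (-(minStrength (G μ f β J) m *
        s ^ minType (G μ f β J) m / (minType (G μ f β J) m).factorial)) := by
  obtain ⟨heven, hpos⟩ := even_minType_G_and_minStrength_pos μ hf ha hm
  have hp := minType_G_pos μ hf ha m
  have hp2 : 2 ≤ minType (G μ f β J) m := by obtain ⟨k, hk⟩ := heven; omega
  refine integral_exp_pos ?_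
  have := integrable_exp_neg_mul_pow hp2 heven (c := minStrength (G μ f β J) m /
    (minType (G μ f β J) m).factorial) (by positivity)
  refine this.congr (ae_of_all _ fun s => ?_)
  simp only
  ring_nf

theorem weight_pos (hf : Continuous f) (ha : 0 < β * J) {m : ℝ}
    (hm : m ∈ minimizers (G μ f β J)) {n : ℕ} (hn : n ≠ 0) : 0 < weight μ T f β J x m n := by
  have hn' : (0 : ℝ) < n := by exact_mod_cast Nat.pos_of_ne_zero hn
  rw [weight_eq hf ha hm]
  have := integral_exp_neg_minStrength_pos hf ha hm
  positivity

theorem div_weight_eq (hf : Continuous f) (ha : 0 < β * J) {m : ℝ}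
    (hm : m ∈ minimizers (G μ f β J)) {n : ℕ} (hn : n ≠ 0) (I : ℝ) :
    I / weight μ T f β J x m n = (n : ℝ) ^ (1 / (minType (G μ f β J) m : ℝ)) *
      Real.exp (n * Gn T f β J x n m) * I / ∫ s : ℝ, Real.exp (-(minStrength (G μ f β J) m *
        s ^ minType (G μ f β J) m / (minType (G μ f β J) m).factorial)) := by
  have hn' : (0 : ℝ) < n := by exact_mod_cast Nat.pos_of_ne_zero hn
  have h := (integral_exp_neg_minStrength_pos hf ha hm).ne'
  have h2 := (Real.rpow_pos_of_pos hn' (1 / (minType (G μ f β J) m : ℝ))).ne'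
  rw [weight_eq hf ha hm, neg_div, Real.rpow_neg hn'.le, Real.exp_neg]
  field_simp

/-- Away from the minima, the Laplace integral is negligible. -/
theorem tendsto_setIntegral_compl_div_weight [CompactSpace E] (hT : Continuous T)
    (hμ : UniquelyErgodic T μ)
    (hf : Continuous f) (ha : 0 < β * J) (x : E) {U : Set ℝ} (hU : IsOpen U) {m : ℝ}
    (hm : m ∈ minimizers (G μ f β J)) (hMU : minimizers (G μ f β J) ⊆ U) (h : ℝ →ᵇ ℝ) :
    Tendsto (fun n : ℕ => (∫ s in Uᶜ, h s * Real.exp (-(n * Gn T f β J x n s))) /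
      weight μ T f β J x m n) atTop (𝓝 0) := by
  obtain ⟨ε, hε, hlow⟩ := exists_eventually_le_Gn hT hμ hf ha x hU hm hMU
  set γ := G μ f β J m
  set p := minType (G μ f β J) m with hp
  set κ := ∫ s : ℝ, Real.exp (-(minStrength (G μ f β J) m * s ^ p / p.factorial)) with hκ
  have hκ0 : 0 < κ := integral_exp_neg_minStrength_pos hf ha hm
  set C := ∫ s : ℝ, ‖h‖ * (Real.exp (β * J) * Real.exp (-(β * J / 4) * s ^ 2)) with hC
  have hCint : Integrable fun s : ℝ =>
      ‖h‖ * (Real.exp (β * J) * Real.exp (-(β * J / 4) * s ^ 2)) :=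
    ((integrable_exp_neg_mul_sq (by positivity)).const_mul _).const_mul _
  have hC0 : 0 ≤ C := integral_nonneg fun s => by positivity
  have hup : ∀ᶠ n in atTop, Gn T f β J x n m < γ + ε / 2 :=
    (tendsto_Gn hT hμ hf β J x m).eventually_lt_const (by linarith)
  have hlim : Tendsto (fun n : ℕ => C * Real.exp (γ + ε) / κ *
      ((n : ℝ) ^ (1 / (p : ℝ)) * Real.exp (-(ε / 2) * n))) atTop (𝓝 0) := by
    have h1 := (tendsto_rpow_mul_exp_neg_mul_atTop_nhds_zero (1 / (p : ℝ)) (ε / 2)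
      (by positivity)).comp tendsto_natCast_atTop_atTop
    simpa using h1.const_mul (C * Real.exp (γ + ε) / κ)
  refine squeeze_zero_norm' ?_ hlim
  filter_upwards [hlow, hup, eventually_ge_atTop 1] with n hlow hup hn
  have hn0 : n ≠ 0 := by omega
  have hn' : (1 : ℝ) ≤ n := by exact_mod_cast hn
  have hI : ‖∫ s in Uᶜ, h s * Real.exp (-(n * Gn T f β J x n s))‖ ≤
      Real.exp (-((n - 1) * (γ + ε))) * C := by
    rw [hC, ← integral_const_mul]
    refine (norm_integral_le_of_norm_le (hCint.const_mul _).integrableOn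
      ((ae_restrict_iff' hU.isClosed_compl.measurableSet).2 (ae_of_all _ fun s hs => ?_))).trans
      (setIntegral_le_integral (hCint.const_mul _) (ae_of_all _ fun s => by positivity))
    rw [norm_mul, Real.norm_eq_abs (Real.exp _), Real.abs_exp]
    -- One copy of `Gn` is kept for integrability and the other `n - 1` are bounded below by `γ +
    -- ε`. Since the weight only costs `n (γ + ε/2)` in the exponent, the quotient is of order
    -- `n^(1/p) exp (-ε n / 2)`.
    have e1 : -(n * Gn T f β J x n s) =
        -((n - 1) * Gn T f β J x n s) + -Gn T f β J x n s := by ring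
    rw [e1, Real.exp_add, mul_left_comm]
    refine mul_le_mul (Real.exp_le_exp.2 ?_) (mul_le_mul (h.norm_coe_le_norm s)
      (exp_neg_mul_Gn_le ha hn0 s) (Real.exp_pos _).le (norm_nonneg _)) (by positivity)
      (Real.exp_pos _).le
    have := mul_le_mul_of_nonneg_left (hlow s hs) (by linarith : (0 : ℝ) ≤ n - 1)
    linarith
  rw [div_weight_eq hf ha hm hn0, norm_div, norm_mul, Real.norm_of_nonneg hκ0.le,
    Real.norm_of_nonneg (by positivity)]
  calc (n : ℝ) ^ (1 / (p : ℝ)) * Real.exp (n * Gn T f β J x n m) *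
        ‖∫ s in Uᶜ, h s * Real.exp (-(n * Gn T f β J x n s))‖ / κ
      ≤ (n : ℝ) ^ (1 / (p : ℝ)) * Real.exp (n * (γ + ε / 2)) *
        (Real.exp (-((n - 1) * (γ + ε))) * C) / κ := by gcongr
    _ = C / κ * (n : ℝ) ^ (1 / (p : ℝ)) *
        (Real.exp (n * (γ + ε / 2)) * Real.exp (-((n - 1) * (γ + ε)))) := by ring
    _ = C / κ * (n : ℝ) ^ (1 / (p : ℝ)) * (Real.exp (γ + ε) * Real.exp (-(ε / 2) * n)) := by
        rw [← Real.exp_add, ← Real.exp_add]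
        congr 2
        ring
    _ = _ := by ring

/-- The discrepancy condition gives the decay of the Taylor coefficients of `G_n`. -/
theorem tendsto_rpow_mul_iteratedDeriv_Gn (hf : Continuous f) {m : ℝ} {j p : ℕ} (hj : 1 ≤ j)
    (hjp : j ≤ p) (hp : p = minType (G μ f β J) m)
    (hd : (fun y : E => iteratedDeriv j (fun s : ℝ => L (f y) s) (β * J * m)) ∈
      DiscrepancyClass T μ ((j : ℝ) / p)) :
    Tendsto (fun n : ℕ => (n : ℝ) ^ (1 - (j : ℝ) / p) * iteratedDeriv j (Gn T f β J x n) m) atTop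
      (𝓝 (if j = p then minStrength (G μ f β J) m else 0)) := by
  set u : E → ℝ := fun y => iteratedDeriv j (L (f y)) (β * J * m) with hu
  have ho := (hd.2 x).tendsto_div_nhds_zero
  -- The quadratic parts of `Gn` and `G` cancel, so the difference of their derivatives is `-(β J)^j
  -- / n` times the discrepancy sum. Multiplying by `n^(1 - j/p)` divides that sum by `n^(j/p)`,
  -- exactly the normalization of `DiscrepancyClass`. What is left is `G^(j)(m)`, which vanishes for
  -- `j < p`.
  have hdiff : ∀ᶠ n : ℕ in atTop, (n : ℝ) ^ (1 - (j : ℝ) / p) * iteratedDeriv j (Gn T f β J x n) m =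
      (n : ℝ) ^ (1 - (j : ℝ) / p) * iteratedDeriv j (G μ f β J) m - (β * J) ^ j *
        ((∑ k ∈ Finset.Icc 1 n, (u (T^[k] x) - ∫ y, u y ∂μ)) / (n : ℝ) ^ ((j : ℝ) / p)) := by
    filter_upwards [eventually_ne_atTop 0] with n hn
    have hn' : (0 : ℝ) < n := by exact_mod_cast Nat.pos_of_ne_zero hn
    have := isProbabilityMeasure_empiricalMeasure T x hn
    have hr := (Real.rpow_pos_of_pos hn' ((j : ℝ) / p)).ne'
    rw [Gn_eq_G, iteratedDeriv_G _ hf, iteratedDeriv_G _ hf, integral_empiricalMeasure,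
      Finset.sum_sub_distrib, Finset.sum_const, Nat.card_Icc, add_tsub_cancel_right, nsmul_eq_mul,
      Real.rpow_sub hn', Real.rpow_one]
    field_simp
    ring
  refine Tendsto.congr' (hdiff.mono fun n hn => hn.symm) ?_
  have hlim : Tendsto (fun n : ℕ => (n : ℝ) ^ (1 - (j : ℝ) / p) * iteratedDeriv j (G μ f β J) m)
      atTop (𝓝 (if j = p then minStrength (G μ f β J) m else 0)) := by
    split_ifs with h
    · subst h
      have hj0 : (j : ℝ) ≠ 0 := by positivity
      rw [div_self hj0, sub_self]
      simp [minStrength, ← hp]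
    · rw [iteratedDeriv_eq_zero_of_lt_minType hj (by omega)]
      simp
  simpa using hlim.sub (ho.const_mul ((β * J) ^ j))

end

/-! ### Asymptotics of the Laplace integral -/

section

variable {E : Type*} [MetricSpace E] [MeasurableSpace E] [BorelSpace E]
  {μ : Measure E} [IsProbabilityMeasure μ] {T : E → E} {f : E → unitInterval} {β J : ℝ} {x : E}

/-- The constant in the Taylor remainder of order `p` of `G_n`. -/
noncomputable def taylorConst (a : ℝ) (p : ℕ) : ℝ :=
  (a + (2 * a) ^ (p + 1) * (p + 1).factorial) / (p + 1).factorial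

theorem abs_Gn_sub_taylor_le (hf : Continuous f) (ha : 0 < β * J) {p : ℕ} (hp : 0 < p) {n : ℕ}
    (hn : n ≠ 0) (m s : ℝ) :
    |Gn T f β J x n s - Gn T f β J x n m -
      ∑ j ∈ Finset.Icc 1 p, iteratedDeriv j (Gn T f β J x n) m * (s - m) ^ j / j.factorial| ≤
      taylorConst (β * J) p * |s - m| ^ (p + 1) := by
  have := isProbabilityMeasure_empiricalMeasure T x hn
  have hF := contDiff_Gn (T := T) (β := β) (J := J) (x := x) hf hn
  have h := abs_sub_taylor_le (F := Gn T f β J x n) (p := p)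
    (hF.of_le (by exact_mod_cast le_top))
    (fun s => by rw [Gn_eq_G]; exact abs_iteratedDeriv_G_le' _ hf ha hp s) m s
  have hr : Finset.range (p + 1) = insert 0 (Finset.Icc 1 p) := by
    ext j; simp only [Finset.mem_range, Finset.mem_insert, Finset.mem_Icc]; omega
  rw [hr, Finset.sum_insert (by simp), ← sub_sub] at h
  simpa [taylorConst] using h

theorem tendsto_setIntegral_ball_div_weight (hf : Continuous f) (ha : 0 < β * J) {m : ℝ}
    (hm : m ∈ minimizers (G μ f β J))
    (hd : ∀ j ∈ Finset.Icc 1 (minType (G μ f β J) m),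
      (fun y : E => iteratedDeriv j (fun s : ℝ => L (f y) s) (β * J * m)) ∈
        DiscrepancyClass T μ ((j : ℝ) / (minType (G μ f β J) m : ℝ)))
    {δ : ℝ} (hδ : 0 < δ)
    (hδK : taylorConst (β * J) (minType (G μ f β J) m) * δ ≤
      minStrength (G μ f β J) m / (minType (G μ f β J) m).factorial / 4) (h : ℝ →ᵇ ℝ) :
    Tendsto (fun n : ℕ => (∫ s in Metric.ball m δ, h s * Real.exp (-(n * Gn T f β J x n s))) /
      weight μ T f β J x m n) atTop (𝓝 (h m)) := by
  obtain ⟨heven, hpos⟩ := even_minType_G_and_minStrength_pos μ hf ha hm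
  have hp := minType_G_pos μ hf ha m
  have hκ := integral_exp_neg_minStrength_pos hf ha hm
  have hcont : ∀ n, Continuous (Gn T f β J x n) := by
    intro n
    -- `contDiff_Gn` requires `n ≠ 0`; for `n = 0` the sum is empty and `Gn` is a plain quadratic.
    rcases eq_or_ne n 0 with rfl | hn
    · have : Gn T f β J x 0 = fun s => β * J / 2 * s ^ 2 := by ext; simp [Gn]
      rw [this]
      fun_prop
    · exact (contDiff_Gn hf hn).continuous
  have hmain := tendsto_local_laplace (g := Gn T f β J x) hcont hp heven
    (c := fun n j => iteratedDeriv j (Gn T f β J x n) m)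
    (by unfold taylorConst; positivity) hpos
    ((eventually_ne_atTop 0).mono fun n hn s => abs_Gn_sub_taylor_le hf ha hp hn m s)
    (fun j hj => tendsto_rpow_mul_iteratedDeriv_Gn hf (Finset.mem_Icc.1 hj).1
      (Finset.mem_Icc.1 hj).2 rfl (hd j hj)) hδ hδK h
  have := hmain.div_const (∫ s : ℝ, Real.exp (-(minStrength (G μ f β J) m *
        s ^ minType (G μ f β J) m / (minType (G μ f β J) m).factorial)))
  rw [mul_div_cancel_right₀ _ hκ.ne'] at this
  refine this.congr' ?_
  filter_upwards [eventually_ne_atTop 0] with n hn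
  rw [div_weight_eq hf ha hm hn]

/-- Both requirements hold for all small `δ > 0`. The first keeps the Taylor remainder below the
leading term in each ball; the second lets the integral over the union of balls split into a sum. -/
theorem exists_radius (M : Finset ℝ) {A B : ℝ → ℝ} (hB : ∀ m ∈ M, 0 < B m) :
    ∃ δ > 0, (∀ m ∈ M, A m * δ ≤ B m) ∧
      (M : Set ℝ).Pairwise fun m m' => Disjoint (Metric.ball m δ) (Metric.ball m' δ) := by
  have h1 : ∀ᶠ δ in 𝓝[>] (0 : ℝ), ∀ m ∈ M, A m * δ ≤ B m := by
    rw [Filter.eventually_all_finset]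
    intro m hm
    have : Tendsto (fun δ => A m * δ) (𝓝[>] 0) (𝓝 0) := by
      have : Continuous fun δ => A m * δ := by fun_prop
      simpa using (this.tendsto 0).mono_left nhdsWithin_le_nhds
    exact this.eventually_le_const (hB m hm)
  have h2 : ∀ᶠ δ in 𝓝[>] (0 : ℝ), ∀ m ∈ M, ∀ m' ∈ M, m ≠ m' →
      Disjoint (Metric.ball m δ) (Metric.ball m' δ) := by
    rw [Filter.eventually_all_finset]
    intro m hm
    rw [Filter.eventually_all_finset]
    intro m' hm'
    by_cases hne : m = m'
    · simp [hne]
    have hd : 0 < dist m m' := dist_pos.2 hne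
    have : Tendsto (fun δ : ℝ => δ + δ) (𝓝[>] 0) (𝓝 0) := by
      have : Continuous fun δ : ℝ => δ + δ := by fun_prop
      simpa using (this.tendsto 0).mono_left nhdsWithin_le_nhds
    filter_upwards [this.eventually_le_const hd] with δ hδ _
    exact Metric.ball_disjoint_ball hδ
  obtain ⟨δ, hδ1, hδ2, hδ⟩ := (h1.and (h2.and self_mem_nhdsWithin)).exists
  exact ⟨δ, hδ, hδ1, fun m hm m' hm' hne => hδ2 m hm m' hm' hne⟩

/-- The asymptotic behaviour of the integrals `∫ h exp (-n G_n)`. -/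
theorem tendsto_integral_div_sum_weight [CompactSpace E] (hT : Continuous T)
    (hμ : UniquelyErgodic T μ)
    (hf : Continuous f) (ha : 0 < β * J) (x : E) {M : Finset ℝ}
    (hM : (M : Set ℝ) = minimizers (G μ f β J)) (hMne : M.Nonempty)
    (hd : ∀ m ∈ M, ∀ j ∈ Finset.Icc 1 (minType (G μ f β J) m),
      (fun y : E => iteratedDeriv j (fun s : ℝ => L (f y) s) (β * J * m)) ∈
        DiscrepancyClass T μ ((j : ℝ) / (minType (G μ f β J) m : ℝ))) (h : ℝ →ᵇ ℝ) :
    Tendsto (fun n : ℕ => (∫ s, h s * Real.exp (-(n * Gn T f β J x n s))) /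
        (∑ m ∈ M, weight μ T f β J x m n) -
      (∑ m ∈ M, weight μ T f β J x m n * h m) / ∑ m ∈ M, weight μ T f β J x m n)
      atTop (𝓝 0) := by
  have hmem : ∀ m ∈ M, m ∈ minimizers (G μ f β J) := fun m hm => hM ▸ hm
  obtain ⟨δ, hδ, hδK, hdisj⟩ := exists_radius M
    (A := fun m => taylorConst (β * J) (minType (G μ f β J) m))
    (B := fun m => minStrength (G μ f β J) m / (minType (G μ f β J) m).factorial / 4)
    (fun m hm => by
      have := (even_minType_G_and_minStrength_pos μ hf ha (hmem m hm)).2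
      positivity)
  set U : Set ℝ := ⋃ m ∈ M, Metric.ball m δ with hU
  have hUopen : IsOpen U := isOpen_biUnion fun _ _ => Metric.isOpen_ball
  have hMU : minimizers (G μ f β J) ⊆ U := by
    rw [← hM]
    exact fun m hm => Set.mem_biUnion hm (Metric.mem_ball_self hδ)
  obtain ⟨m₀, hm₀⟩ := hMne
  set F : ℕ → ℝ → ℝ := fun n s => h s * Real.exp (-(n * Gn T f β J x n s)) with hF
  set w : ℝ → ℕ → ℝ := weight μ T f β J x with hw
  have hout := tendsto_setIntegral_compl_div_weight hT hμ hf ha x hUopen (hmem m₀ hm₀) hMU h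
  have hballs := tendsto_finsetSum M fun m hm =>
    ((tendsto_setIntegral_ball_div_weight (x := x) hf ha (hmem m hm) (hd m hm) hδ (hδK m hm)
      h).sub_const (h m)).abs
  have hlim : Tendsto (fun n : ℕ => ∑ m ∈ M, |(∫ s in Metric.ball m δ, F n s) / w m n - h m| +
      |(∫ s in Uᶜ, F n s) / w m₀ n|) atTop (𝓝 0) := by
    simpa using hballs.add hout.abs
  refine squeeze_zero_norm' ?_ hlim
  filter_upwards [eventually_ne_atTop 0] with n hn
  have hwpos : ∀ m ∈ M, 0 < w m n := fun m hm => weight_pos hf ha (hmem m hm) hn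
  have hwle : ∀ m ∈ M, w m n ≤ ∑ m ∈ M, w m n := fun m hm =>
    Finset.single_le_sum (f := fun m => w m n) (fun m hm => (hwpos m hm).le) hm
  have hBpos : 0 < ∑ m ∈ M, w m n := (hwpos m₀ hm₀).trans_le (hwle m₀ hm₀)
  have hint : Integrable (F n) := integrable_mul_exp_neg_Gn hf ha hn h
  have hsplit : ∫ s, F n s = ∑ m ∈ M, (∫ s in Metric.ball m δ, F n s) + ∫ s in Uᶜ, F n s := by
    rw [← integral_add_compl hUopen.measurableSet hint, hU, integral_biUnion_finset M
      (fun _ _ => Metric.isOpen_ball.measurableSet) hdisj fun _ _ => hint.integrableOn]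
  -- All weights are positive, so dividing by their sum costs no more than dividing by any single
  -- one. The errors of the separate balls can thus be added without comparing weights of different
  -- minima.
  have key : ∀ {I : ℝ} {m : ℝ}, m ∈ M → |I / ∑ m ∈ M, w m n| ≤ |I / w m n| := by
    intro I m hm
    rw [abs_div, abs_div, abs_of_pos hBpos, abs_of_pos (hwpos m hm)]
    exact div_le_div_of_nonneg_left (abs_nonneg _) (hwpos m hm) (hwle m hm)
  change ‖(∫ s, F n s) / (∑ m ∈ M, w m n) - (∑ m ∈ M, w m n * h m) / ∑ m ∈ M, w m n‖ ≤ _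
  rw [← sub_div, hsplit, add_sub_right_comm, ← Finset.sum_sub_distrib, add_div, Finset.sum_div,
    Real.norm_eq_abs]
  refine (abs_add_le _ _).trans (add_le_add ((Finset.abs_sum_le_sum_abs _ _).trans
    (Finset.sum_le_sum fun m hm => (key hm).trans_eq ?_)) (key hm₀))
  rw [sub_div, mul_div_cancel_left₀ _ (hwpos m hm).ne']

/-- The normalized Laplace integrals follow the weighted means over the minima. -/
theorem tendsto_integral_div_integral_sub [CompactSpace E] (hT : Continuous T)
    (hμ : UniquelyErgodic T μ)
    (hf : Continuous f) (ha : 0 < β * J) (x : E) {M : Finset ℝ}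
    (hM : (M : Set ℝ) = minimizers (G μ f β J)) (hMne : M.Nonempty)
    (hd : ∀ m ∈ M, ∀ j ∈ Finset.Icc 1 (minType (G μ f β J) m),
      (fun y : E => iteratedDeriv j (fun s : ℝ => L (f y) s) (β * J * m)) ∈
        DiscrepancyClass T μ ((j : ℝ) / (minType (G μ f β J) m : ℝ))) (h : ℝ →ᵇ ℝ) :
    Tendsto (fun n : ℕ => (∫ s, h s * Real.exp (-(n * Gn T f β J x n s))) /
        (∫ s, Real.exp (-(n * Gn T f β J x n s))) -
      (∑ m ∈ M, weight μ T f β J x m n * h m) / ∑ m ∈ M, weight μ T f β J x m n)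
      atTop (𝓝 0) := by
  have hmem : ∀ m ∈ M, m ∈ minimizers (G μ f β J) := fun m hm => hM ▸ hm
  set w : ℝ → ℕ → ℝ := weight μ T f β J x with hw
  set N : ℕ → ℝ := fun n => ∫ s, h s * Real.exp (-(n * Gn T f β J x n s)) with hN
  set Z : ℕ → ℝ := fun n => ∫ s, Real.exp (-(n * Gn T f β J x n s)) with hZ
  set B : ℕ → ℝ := fun n => ∑ m ∈ M, w m n with hB
  set A : ℕ → ℝ := fun n => ∑ m ∈ M, w m n * h m with hA
  have h1 : Tendsto (fun n => N n / B n - A n / B n) atTop (𝓝 0) :=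
    tendsto_integral_div_sum_weight hT hμ hf ha x hM hMne hd h
  have hBpos : ∀ᶠ n in atTop, 0 < B n := by
    filter_upwards [eventually_ne_atTop 0] with n hn
    exact Finset.sum_pos (fun m hm => weight_pos hf ha (hmem m hm) hn) hMne
  -- Taking `h = 1` shows that the normalizing integral is equivalent to the sum of the weights.
  have h2 : Tendsto (fun n => Z n / B n) atTop (𝓝 1) := by
    have := tendsto_integral_div_sum_weight hT hμ hf ha x hM hMne hd
      (BoundedContinuousFunction.const ℝ 1)
    simp only [BoundedContinuousFunction.const_apply, one_mul, mul_one] at this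
    have h3 := this.add_const 1
    rw [zero_add] at h3
    refine h3.congr' (hBpos.mono fun n hn => ?_)
    change Z n / B n - B n / B n + 1 = Z n / B n
    rw [div_self hn.ne']
    ring
  have hbdd : ∀ᶠ n in atTop, |A n / B n| ≤ ‖h‖ := by
    filter_upwards [hBpos, eventually_ne_atTop 0] with n hn hn0
    rw [abs_div, abs_of_pos hn, div_le_iff₀ hn, hA, hB, Finset.mul_sum]
    refine (Finset.abs_sum_le_sum_abs _ _).trans (Finset.sum_le_sum fun m hm => ?_)
    have := weight_pos (x := x) (T := T) hf ha (hmem m hm) hn0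
    rw [abs_mul, abs_of_pos this, mul_comm]
    exact mul_le_mul_of_nonneg_right (h.norm_coe_le_norm m) this.le
  have h4 : Tendsto (fun n => A n / B n * ((Z n / B n)⁻¹ - 1)) atTop (𝓝 0) := by
    have : Tendsto (fun n => (Z n / B n)⁻¹ - 1) atTop (𝓝 0) := by
      simpa using (h2.inv₀ one_ne_zero).sub_const 1
    refine squeeze_zero_norm' (a := fun n => ‖h‖ * |(Z n / B n)⁻¹ - 1|) ?_
      (by simpa using this.abs.const_mul ‖h‖)
    filter_upwards [hbdd] with n hn
    rw [norm_mul]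
    exact mul_le_mul_of_nonneg_right hn (abs_nonneg _)
  -- Uses `N/Z - A/B = (N/B - A/B) (Z/B)⁻¹ + (A/B) ((Z/B)⁻¹ - 1)`, where `A/B` is bounded by `‖h‖`
  -- but need not converge.
  have h5 := (h1.mul (h2.inv₀ one_ne_zero)).add h4
  simp only [inv_one, mul_one, add_zero] at h5
  refine h5.congr' ?_
  filter_upwards [hBpos, h2.eventually_ne one_ne_zero] with n hn hne
  have : (Z n / B n)⁻¹ = B n / Z n := inv_div _ _
  rw [this]
  have hBn := hn.ne'
  have hZn : Z n ≠ 0 := fun h0 => hne (by rw [h0, zero_div])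
  change _ = N n / Z n - A n / B n
  field_simp
  ring

end

/-! ### The moment generating function of the random walk -/

theorem abs_magnetization_div_le_one {n : ℕ} (σ : Config n) : |magnetization σ / n| ≤ 1 := by
  rw [abs_div, Nat.abs_cast]
  refine div_le_one_of_le₀ ((Finset.abs_sum_le_sum_abs _ _).trans_eq ?_) (Nat.cast_nonneg n)
  have : ∀ i, |((σ i : ℤ) : ℝ)| = 1 := fun i => by
    rcases Int.units_eq_one_or (σ i) with h | h <;> simp [h]
  simp [this]

/-- The probability of a configuration for the random walk without interaction. -/
noncomputable def walkProb {E : Type*} (T : E → E) (f : E → unitInterval) (x : E) {n : ℕ}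
    (σ : Config n) : ℝ := ∏ i : Fin n, stepProb (f (T^[i + 1] x)) (σ i)

theorem walkProb_nonneg {E : Type*} (T : E → E) (f : E → unitInterval) (x : E) {n : ℕ}
    (σ : Config n) : 0 ≤ walkProb T f x σ :=
  Finset.prod_nonneg fun _ _ => stepProb_nonneg _ _

/-- The steps are independent, so the moment generating function factorizes, and each factor is `exp
(L φ t)`. The formula is exact; only the empirical measure depends on `n`. -/
theorem sum_walkProb_mul_exp {E : Type*} [MeasurableSpace E] [MeasurableSingletonClass E]
    (T : E → E) (f : E → unitInterval) (x : E) {n : ℕ} (hn : n ≠ 0) (t : ℝ) :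
    ∑ σ : Config n, walkProb T f x σ * Real.exp (t * magnetization σ) =
      Real.exp (n * Lam (empiricalMeasure T x n) f t) := by
  have hn' : (n : ℝ) ≠ 0 := by exact_mod_cast hn
  have h1 : ∀ σ : Config n, walkProb T f x σ * Real.exp (t * magnetization σ) =
      ∏ i : Fin n, stepProb (f (T^[i + 1] x)) (σ i) * Real.exp (t * ((σ i : ℤ) : ℝ)) := by
    intro σ
    rw [walkProb, magnetization, Finset.mul_sum, Real.exp_sum, Finset.prod_mul_distrib]
  have h2 : ∀ φ : unitInterval, ∑ u : ℤˣ, stepProb φ u * Real.exp (t * ((u : ℤ) : ℝ)) =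
      Real.exp (L φ t) := by
    intro φ
    rw [exp_L, units_int_univ, Finset.sum_pair (by decide)]
    simp [stepProb, stepMGF]
  simp only [h1]
  rw [← Fintype.prod_sum (fun (i : Fin n) (u : ℤˣ) =>
    stepProb (f (T^[i + 1] x)) u * Real.exp (t * ((u : ℤ) : ℝ)))]
  simp only [h2]
  rw [← Real.exp_sum, Lam, integral_empiricalMeasure, ← mul_assoc, mul_one_div_cancel hn', one_mul,
    Fin.sum_univ_eq_sum_range (fun i => L (f (T^[i + 1] x)) t), Finset.range_eq_Ico,
    Finset.sum_Ico_add' (fun i => L (f (T^[i] x)) t)]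
  rfl

theorem gibbsWeight_eq {E : Type*} (T : E → E) (f : E → unitInterval) (β J : ℝ) (x : E) {n : ℕ}
    (σ : Config n) : gibbsWeight T f β J x σ =
      walkProb T f x σ * Real.exp (n * (β * J / 2 * (magnetization σ / n) ^ 2)) := by
  rw [gibbsWeight, walkProb, mul_comm]
  congr 2
  rcases eq_or_ne n 0 with rfl | hn
  · simp
  · field_simp

/-! ### The Hubbard–Stratonovich transformation -/

/-- Insert the moment generating function at `β J s` and complete the square: `β J s M - n β J s²/2
= n β J/2 (M/n)² - n β J/2 (s - M/n)²`. The first square is the interaction energy. -/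
theorem exp_neg_mul_Gn_eq {E : Type*} [MeasurableSpace E] [MeasurableSingletonClass E]
    (T : E → E) (f : E → unitInterval) (β J : ℝ) (x : E) {n : ℕ} (hn : n ≠ 0) (s : ℝ) :
    Real.exp (-(n * Gn T f β J x n s)) = ∑ σ : Config n, gibbsWeight T f β J x σ *
      Real.exp (-(n * (β * J) / 2 * (s - magnetization σ / n) ^ 2)) := by
  have h := sum_walkProb_mul_exp T f x hn (β * J * s)
  have e1 : -(n * Gn T f β J x n s) = -(n * (β * J / 2 * s ^ 2)) +
      n * Lam (empiricalMeasure T x n) f (β * J * s) := by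
    rw [Gn_eq_G, G_eq]; ring
  rw [e1, Real.exp_add, ← h, Finset.mul_sum]
  refine Finset.sum_congr rfl fun σ _ => ?_
  rw [gibbsWeight_eq, mul_left_comm, mul_assoc (walkProb T f x σ), ← Real.exp_add, ← Real.exp_add]
  congr 2
  field_simp
  ring

open ProbabilityTheory in
theorem integral_mul_exp_eq_gaussianReal {v : NNReal} (hv : v ≠ 0) (y : ℝ) (h : ℝ → ℝ) :
    ∫ s, h s * Real.exp (-(s - y) ^ 2 / (2 * v)) =
      √(2 * Real.pi * v) * ∫ s, h s ∂(gaussianReal y v) := by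
  have hv' : (0 : ℝ) < v := by exact_mod_cast pos_iff_ne_zero.2 hv
  have h0 : √(2 * Real.pi * v) ≠ 0 := by positivity
  rw [integral_gaussianReal_eq_integral_smul hv, ← integral_const_mul]
  refine integral_congr_ae (ae_of_all _ fun s => ?_)
  simp only [gaussianPDFReal, smul_eq_mul]
  field_simp

/-- The Laplace integrals are smoothings of the Gibbs expectations by Gaussian kernels. -/
theorem integral_mul_exp_neg_Gn {E : Type*} [MeasurableSpace E] [MeasurableSingletonClass E]
    (T : E → E) (f : E → unitInterval) {β J : ℝ} (x : E) {n : ℕ} (hn : n ≠ 0) {v : NNReal}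
    (hv : v ≠ 0) (hvn : n * (β * J) * v = 1) (h : ℝ →ᵇ ℝ) :
    ∫ s, h s * Real.exp (-(n * Gn T f β J x n s)) = √(2 * Real.pi * v) *
      ∑ σ : Config n, gibbsWeight T f β J x σ *
        ∫ s, h s ∂(ProbabilityTheory.gaussianReal (magnetization σ / n) v) := by
  have hv' : (0 : ℝ) < v := by exact_mod_cast pos_iff_ne_zero.2 hv
  have hna : n * (β * J) = (v : ℝ)⁻¹ := eq_inv_of_mul_eq_one_left hvn
  have hcongr : ∀ s, h s * Real.exp (-(n * Gn T f β J x n s)) = ∑ σ : Config n,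
      gibbsWeight T f β J x σ *
        (h s * Real.exp (-(s - magnetization σ / n) ^ 2 / (2 * v))) := by
    intro s
    rw [exp_neg_mul_Gn_eq T f β J x hn, Finset.mul_sum]
    refine Finset.sum_congr rfl fun σ _ => ?_
    rw [mul_left_comm, hna]
    congr 3
    field_simp
  simp only [hcongr]
  rw [integral_finsetSum, Finset.mul_sum]
  · refine Finset.sum_congr rfl fun σ _ => ?_
    rw [integral_const_mul, integral_mul_exp_eq_gaussianReal hv]
    ring
  · intro σ _
    refine Integrable.const_mul ?_ _
    have hi : Integrable fun s : ℝ => Real.exp (-(s - magnetization σ / n) ^ 2 / (2 * v)) := by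
      have := (integrable_exp_neg_mul_sq (b := (2 * (v : ℝ))⁻¹) (by positivity)).comp_sub_right
        (magnetization σ / n)
      refine this.congr (ae_of_all _ fun s => ?_)
      simp only
      congr 1
      ring
    exact hi.bdd_mul (c := ‖h‖) h.continuous.aestronglyMeasurable
      (ae_of_all _ fun s => h.norm_coe_le_norm s)

/-- For `s` close to `y` use uniform continuity around `[-1, 1]`; otherwise the bound `2 ‖h‖` is
absorbed by the quadratic term. Integrating against a Gaussian then brings in only its variance. -/
theorem exists_abs_sub_le_add_mul_sq (h : ℝ →ᵇ ℝ) {ε : ℝ} (hε : 0 < ε) :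
    ∃ C ≥ 0, ∀ y, |y| ≤ 1 → ∀ s, |h s - h y| ≤ ε + C * (s - y) ^ 2 := by
  have hu := (isCompact_Icc (a := (-1 : ℝ)) (b := 1)).uniformContinuousAt_of_continuousAt h
    (fun y _ => h.continuous.continuousAt) (Metric.dist_mem_uniformity hε)
  obtain ⟨ρ, hρ, hsub⟩ := Metric.mem_uniformity_dist.1 hu
  refine ⟨2 * ‖h‖ / ρ ^ 2, by positivity, fun y hy s => ?_⟩
  by_cases hsy : dist y s < ρ
  · have h1 : dist (h y) (h s) < ε := hsub hsy (abs_le.1 hy)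
    rw [dist_comm, Real.dist_eq] at h1
    have : 0 ≤ 2 * ‖h‖ / ρ ^ 2 * (s - y) ^ 2 := by positivity
    linarith
  · have h1 : |h s - h y| ≤ 2 * ‖h‖ := by
      have := h.dist_le_two_norm s y
      rwa [Real.dist_eq] at this
    rw [not_lt, Real.dist_eq, abs_sub_comm] at hsy
    have h2 : ρ ^ 2 ≤ (s - y) ^ 2 := by
      rw [← sq_abs (s - y)]; exact pow_le_pow_left₀ hρ.le hsy 2
    have h3 : 2 * ‖h‖ ≤ 2 * ‖h‖ / ρ ^ 2 * (s - y) ^ 2 := by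
      rw [div_mul_eq_mul_div, le_div_iff₀ (by positivity)]
      exact mul_le_mul_of_nonneg_left h2 (by positivity)
    linarith

open ProbabilityTheory in
theorem abs_integral_gaussianReal_sub_le (h : ℝ →ᵇ ℝ) {ε C y : ℝ}
    (hC : ∀ s, |h s - h y| ≤ ε + C * (s - y) ^ 2) (v : NNReal) :
    |∫ s, h s ∂(gaussianReal y v) - h y| ≤ ε + C * v := by
  have hmem : MemLp id 2 (gaussianReal y v) := memLp_id_gaussianReal 2
  have hvar : ∫ s, (s - y) ^ 2 ∂(gaussianReal y v) = v := by
    have h1 := variance_id_gaussianReal (μ := y) (v := v)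
    rw [variance_eq_integral hmem.aemeasurable] at h1
    simpa using h1
  have hint : Integrable (fun s => (s - y) ^ 2) (gaussianReal y v) :=
    (hmem.sub (memLp_const y)).integrable_sq
  have hh : Integrable h (gaussianReal y v) := h.integrable _
  have e1 : ∫ s, h s ∂(gaussianReal y v) - h y = ∫ s, (h s - h y) ∂(gaussianReal y v) := by
    rw [integral_sub hh (integrable_const _)]; simp
  have hg : Integrable (fun s => ε + C * (s - y) ^ 2) (gaussianReal y v) :=
    (integrable_const _).add (hint.const_mul _)
  rw [e1]
  refine (norm_integral_le_of_norm_le (f := fun s => h s - h y) hg (ae_of_all _ hC)).trans_eq ?_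
  rw [integral_add (integrable_const _) (hint.const_mul _), integral_const_mul, hvar]
  simp

theorem gibbsProb_nonneg {E : Type*} (T : E → E) (f : E → unitInterval) (β J : ℝ) (x : E) {n : ℕ}
    (σ : Config n) : 0 ≤ gibbsProb T f β J x σ :=
  div_nonneg (gibbsWeight_nonneg T f β J x σ) (sum_gibbsWeight_pos T f β J x n).le

theorem sum_gibbsProb {E : Type*} (T : E → E) (f : E → unitInterval) (β J : ℝ) (x : E) (n : ℕ) :
    ∑ σ : Config n, gibbsProb T f β J x σ = 1 := by
  simp only [gibbsProb]
  rw [← Finset.sum_div, div_self (sum_gibbsWeight_pos T f β J x n).ne']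

theorem integral_gibbsMeasure {E : Type*} (T : E → E) (f : E → unitInterval) (β J : ℝ) (x : E)
    (n : ℕ) (g : Config n → ℝ) :
    ∫ σ, g σ ∂(gibbsMeasure T f β J x n) = ∑ σ : Config n, gibbsProb T f β J x σ * g σ := by
  rw [gibbsMeasure, integral_finsetSum_measure fun σ _ =>
    (integrable_dirac (by simp)).smul_measure ENNReal.ofReal_ne_top]
  refine Finset.sum_congr rfl fun σ _ => ?_
  rw [integral_smul_measure, integral_dirac, smul_eq_mul,
    ENNReal.toReal_ofReal (gibbsProb_nonneg T f β J x σ)]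

/-- The Gibbs expectations and the normalized Laplace integrals are asymptotically equal. -/
theorem tendsto_integral_gibbsMeasure_sub {E : Type*} [MeasurableSpace E]
    [MeasurableSingletonClass E] (T : E → E) (f : E → unitInterval) {β J : ℝ} (ha : 0 < β * J)
    (x : E) (h : ℝ →ᵇ ℝ) :
    Tendsto (fun n : ℕ => ∫ σ, h (magnetization σ / n) ∂(gibbsMeasure T f β J x n) -
      (∫ s, h s * Real.exp (-(n * Gn T f β J x n s))) /
        ∫ s, Real.exp (-(n * Gn T f β J x n s))) atTop (𝓝 0) := by
  rw [Metric.tendsto_nhds]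
  intro ε hε
  obtain ⟨C, hC0, hC⟩ := exists_abs_sub_le_add_mul_sq h (half_pos hε)
  have hsmall : Tendsto (fun n : ℕ => C * (n * (β * J))⁻¹) atTop (𝓝 0) := by
    have h1 : Tendsto (fun n : ℕ => (n : ℝ) * (β * J)) atTop atTop :=
      tendsto_natCast_atTop_atTop.atTop_mul_const ha
    simpa using h1.inv_tendsto_atTop.const_mul C
  filter_upwards [hsmall.eventually_lt_const (half_pos hε), eventually_ne_atTop 0] with n hlt hn
  have hn' : (0 : ℝ) < n := by exact_mod_cast Nat.pos_of_ne_zero hn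
  have hna : 0 < n * (β * J) := by positivity
  -- The variance `1 / (n β J)` of the Hubbard–Stratonovich kernel. The prefactor `√(2 π v)` is
  -- common to numerator and denominator and cancels.
  set v : NNReal := ⟨(n * (β * J))⁻¹, by positivity⟩ with hv
  have hvc : (v : ℝ) = (n * (β * J))⁻¹ := rfl
  have hv0 : v ≠ 0 := by
    rw [← NNReal.coe_ne_zero, hvc]; positivity
  have hvn : n * (β * J) * (v : ℝ) = 1 := by rw [hvc]; exact mul_inv_cancel₀ hna.ne'
  have hvpos : (0 : ℝ) < v := by rw [hvc]; positivity
  have hZ := integral_mul_exp_neg_Gn T f x hn hv0 hvn (BoundedContinuousFunction.const ℝ 1)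
  simp only [BoundedContinuousFunction.const_apply, one_mul, integral_const, probReal_univ,
    smul_eq_mul, mul_one] at hZ
  have h0 : √(2 * Real.pi * v) ≠ 0 := by positivity
  rw [integral_mul_exp_neg_Gn T f x hn hv0 hvn h, hZ, mul_div_mul_left _ _ h0,
    integral_gibbsMeasure, Finset.sum_div, ← Finset.sum_sub_distrib, dist_zero_right]
  refine lt_of_le_of_lt ((norm_sum_le _ _).trans (Finset.sum_le_sum fun σ _ =>
    (?_ : _ ≤ gibbsProb T f β J x σ * (ε / 2 + C * v)))) ?_
  · have := abs_integral_gaussianReal_sub_le h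
      (hC (magnetization σ / n) (abs_magnetization_div_le_one σ)) v
    rw [mul_div_right_comm]
    change ‖gibbsProb T f β J x σ * _ - gibbsProb T f β J x σ * _‖ ≤ _
    rw [← mul_sub, norm_mul, Real.norm_of_nonneg (gibbsProb_nonneg T f β J x σ), norm_sub_rev]
    exact mul_le_mul_of_nonneg_left this (gibbsProb_nonneg T f β J x σ)
  · rw [← Finset.sum_mul, sum_gibbsProb, one_mul, hvc]
    linarith

/-! ### The rate function -/

theorem EReal_iSup_coe_sub_coe {ι : Type*} (u : ι → ℝ) (r : ℝ) :
    (⨆ i, (u i : EReal)) - (r : EReal) = ⨆ i, ((u i - r : ℝ) : EReal) := by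
  refine le_antisymm ?_ (iSup_le fun i => ?_)
  · rw [EReal.sub_le_iff_le_add (Or.inl (EReal.coe_ne_bot r)) (Or.inl (EReal.coe_ne_top r))]
    refine iSup_le fun i => ?_
    calc (u i : EReal) = ((u i - r : ℝ) : EReal) + r := by rw [← EReal.coe_add, sub_add_cancel]
      _ ≤ _ := by gcongr; exact le_iSup (fun i => ((u i - r : ℝ) : EReal)) i
  · rw [EReal.coe_sub]
    exact EReal.sub_le_sub (le_iSup (fun i => (u i : EReal)) i) le_rfl

section RateFunction

variable {E : Type*} [MeasurableSpace E] (μ : Measure E) (f : E → unitInterval) (β J : ℝ)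

/-- As a supremum of continuous real functions of `z`, the rate is lower semicontinuous, and strict
lower bounds on it are witnessed by a single `t`. -/
theorem tiltedRate_eq_iSup (z : ℝ) :
    tiltedRate μ f β J z = ⨆ t : ℝ, ((t * z - Lam μ f t - β * J / 2 * z ^ 2 : ℝ) : EReal) :=
  EReal_iSup_coe_sub_coe _ _

theorem Lam_zero : Lam μ f 0 = 0 := by simp [Lam, L_zero]

/-- If `|z| > 1`, the left side grows linearly when `t` goes to infinity with the sign of `z`.
Together with `|Λ(t)| ≤ |t|` this confines finite rates to `[-1, 1]`, hence the compact level sets.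
-/
theorem abs_le_one_of_forall_le {z C : ℝ} (h : ∀ t : ℝ, t * z - |t| ≤ C) : |z| ≤ 1 := by
  by_contra! hz
  have hC : 0 ≤ C := by simpa using h 0
  have h0 : 0 < |z| - 1 := by linarith
  have hpos : 0 < (C + 1) / (|z| - 1) := by positivity
  have key : (C + 1) / (|z| - 1) * |z| - (C + 1) / (|z| - 1) = C + 1 := by field_simp
  rcases abs_cases z with ⟨hz1, -⟩ | ⟨hz1, -⟩
  · have := h ((C + 1) / (|z| - 1))
    rw [abs_of_pos hpos] at this
    nlinarith
  · have := h (-((C + 1) / (|z| - 1)))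
    rw [abs_neg, abs_of_pos hpos] at this
    nlinarith

variable {μ f β J} in
theorem abs_le_one_of_tiltedRate_lt_top [IsProbabilityMeasure μ] {z : ℝ}
    (h : tiltedRate μ f β J z < ⊤) : |z| ≤ 1 := by
  obtain ⟨c, hc, -⟩ := EReal.lt_iff_exists_real_btwn.1 h
  rw [tiltedRate_eq_iSup] at hc
  refine abs_le_one_of_forall_le (C := c + β * J / 2 * z ^ 2) fun t => ?_
  have h1 := EReal.coe_le_coe_iff.1 (iSup_le_iff.1 hc.le t)
  have h2 := (abs_le.1 (abs_Lam_le μ f t)).2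
  linarith

variable {β J} in
theorem le_tiltedRate [IsProbabilityMeasure μ] (ha : 0 < β * J) (z : ℝ) :
    ((-(β * J / 2) : ℝ) : EReal) ≤ tiltedRate μ f β J z := by
  rcases eq_or_ne (tiltedRate μ f β J z) ⊤ with h | h
  · rw [h]; exact le_top
  · have hz := abs_le_one_of_tiltedRate_lt_top (lt_top_iff_ne_top.2 h)
    rw [tiltedRate_eq_iSup]
    refine le_iSup_of_le 0 (EReal.coe_le_coe_iff.2 ?_)
    have : z ^ 2 ≤ 1 := (sq_le_one_iff_abs_le_one z).2 hz
    rw [Lam_zero]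
    nlinarith

variable {μ f β J} in
theorem isGoodRateFunction_rateFunction [IsProbabilityMeasure μ] {k : ℝ}
    (hk : ⨅ w : ℝ, tiltedRate μ f β J w = k) :
    IsGoodRateFunction (rateFunction μ f β J) := by
  have heq : ∀ z, rateFunction μ f β J z =
      ⨆ t : ℝ, ((t * z - Lam μ f t - β * J / 2 * z ^ 2 - k : ℝ) : EReal) := fun z => by
    rw [rateFunction, hk, tiltedRate_eq_iSup, EReal_iSup_coe_sub_coe]
  have hlsc : LowerSemicontinuous (rateFunction μ f β J) := by
    rw [funext heq]
    refine lowerSemicontinuous_iSup fun t => Continuous.lowerSemicontinuous ?_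
    exact continuous_coe_real_ereal.comp (by fun_prop)
  refine ⟨fun z => ?_, hlsc, fun a _ => ?_⟩
  · rw [rateFunction, hk, EReal.sub_nonneg (Or.inr (EReal.coe_ne_top k))
    (Or.inr (EReal.coe_ne_bot k)),
      ← hk]
    exact iInf_le _ z
  · refine (isCompact_Icc (a := (-1 : ℝ)) (b := 1)).of_isClosed_subset
      (hlsc.isClosed_preimage (a : EReal)) fun z hz => abs_le.1 ?_
    refine abs_le_one_of_forall_le (C := a + β * J / 2 * z ^ 2 + k) fun t => ?_
    have hz' : rateFunction μ f β J z ≤ a := hz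
    rw [heq] at hz'
    have h1 := EReal.coe_le_coe_iff.1 (iSup_le_iff.1 hz' t)
    have h2 := (abs_le.1 (abs_Lam_le μ f t)).2
    linarith

end RateFunction

/-! ### Exponential estimates for the Gibbs weights -/

open Classical in
/-- The total Gibbs weight of the configurations with `M_n / n ∈ B`. -/
noncomputable def gibbsMass {E : Type*} (T : E → E) (f : E → unitInterval) (β J : ℝ) (x : E) (n : ℕ)
    (B : Set ℝ) : ℝ :=
  ∑ σ : Config n with magnetization σ / n ∈ B, gibbsWeight T f β J x σ

section Mass

variable {E : Type*} (T : E → E) (f : E → unitInterval) (β J : ℝ) (x : E) (n : ℕ)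

/-- The inclusion is needed only inside `[-1, 1]`, where `M_n / n` takes its values. This plays the
role of exponential tightness. -/
theorem gibbsMass_mono {A B : Set ℝ} (h : ∀ z ∈ A, |z| ≤ 1 → z ∈ B) :
    gibbsMass T f β J x n A ≤ gibbsMass T f β J x n B := by
  classical
  refine Finset.sum_le_sum_of_subset_of_nonneg (fun σ hσ => ?_)
    fun σ _ _ => gibbsWeight_nonneg T f β J x σ
  simp only [Finset.mem_filter, Finset.mem_univ, true_and] at hσ ⊢
  exact h _ hσ (abs_magnetization_div_le_one σ)

theorem gibbsMass_union_le (A B : Set ℝ) :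
    gibbsMass T f β J x n (A ∪ B) ≤ gibbsMass T f β J x n A + gibbsMass T f β J x n B := by
  classical
  simp only [gibbsMass, Finset.sum_filter, ← Finset.sum_add_distrib]
  refine Finset.sum_le_sum fun σ _ => ?_
  have := gibbsWeight_nonneg T f β J x σ
  by_cases h1 : magnetization σ / n ∈ A <;> by_cases h2 : magnetization σ / n ∈ B <;>
    simp [h1, h2, this]

theorem gibbsMass_univ : gibbsMass T f β J x n Set.univ =
    ∑ σ : Config n, gibbsWeight T f β J x σ := by
  simp [gibbsMass]

theorem magnetizationLaw_apply {B : Set ℝ} (hB : MeasurableSet B) :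
    (magnetizationLaw T f β J x n : Measure ℝ) B =
      ENNReal.ofReal (gibbsMass T f β J x n B / gibbsMass T f β J x n Set.univ) := by
  classical
  change ((gibbsMeasure T f β J x n).map fun σ => magnetization σ / n) B = _
  rw [Measure.map_apply (measurable_of_finite _) hB, gibbsMass_univ, gibbsMass, Finset.sum_div]
  change _ = ENNReal.ofReal (∑ σ with _, gibbsProb T f β J x σ)
  rw [ENNReal.ofReal_sum_of_nonneg
      fun σ _ => gibbsProb_nonneg T f β J x σ, gibbsMeasure, Finset.sum_filter]
  simp only [Measure.coe_finsetSum, Finset.sum_apply, Measure.smul_apply, smul_eq_mul]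
  refine Finset.sum_congr rfl fun σ _ => ?_
  rw [Measure.dirac_apply]
  by_cases h : magnetization σ / n ∈ B
  · simp [Set.indicator, h, gibbsProb]
  · simp [Set.indicator, h]

end Mass

/-! ### Exponential upper and lower bounds for Gibbs masses -/

section Estimates

variable {E : Type*} [MetricSpace E] [MeasurableSpace E] [BorelSpace E]
  {μ : Measure E} [IsProbabilityMeasure μ] {T : E → E} {f : E → unitInterval}

/-- Exponential Chebyshev inequality with one tilt `t` that is nearly optimal at `z`; by continuity
the same `t` serves a whole neighbourhood, on which the interaction is controlled too. -/
theorem exists_nhds_gibbsMass_le [CompactSpace E] (hT : Continuous T) (hμ : UniquelyErgodic T μ)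
    (hf : Continuous f) (β J : ℝ) (x : E) {z c : ℝ} (hc : (c : EReal) < tiltedRate μ f β J z) :
    ∃ V ∈ 𝓝 z, ∀ᶠ n : ℕ in atTop, gibbsMass T f β J x n V ≤ Real.exp (-(n * c)) := by
  classical
  rw [tiltedRate_eq_iSup, lt_iSup_iff] at hc
  obtain ⟨t, ht⟩ := hc
  rw [EReal.coe_lt_coe_iff] at ht
  -- Half of the available gap: one `η` pays for the variation over `V`, the other for replacing the
  -- empirical `Lam` by its limit.
  set η := (t * z - Lam μ f t - β * J / 2 * z ^ 2 - c) / 2 with hη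
  have hη0 : 0 < η := by rw [hη]; linarith
  have hcont : Continuous fun w : ℝ => β * J / 2 * w ^ 2 - t * w := by fun_prop
  refine ⟨_, (hcont.tendsto z).eventually_lt_const (lt_add_of_pos_right _ hη0), ?_⟩
  filter_upwards [(tendsto_Lam_empiricalMeasure hT hμ hf x t).eventually_lt_const
    (lt_add_of_pos_right _ hη0), eventually_ne_atTop 0] with n hn hn0
  have hn' : (0 : ℝ) < n := by exact_mod_cast Nat.pos_of_ne_zero hn0
  set b := β * J / 2 * z ^ 2 - t * z + η with hb
  calc gibbsMass T f β J x n {w | β * J / 2 * w ^ 2 - t * w < b}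
      ≤ ∑ σ : Config n with magnetization σ / n ∈ {w | β * J / 2 * w ^ 2 - t * w < b},
          walkProb T f x σ * Real.exp (t * magnetization σ) * Real.exp (n * b) := by
        refine Finset.sum_le_sum fun σ hσ => ?_
        rw [gibbsWeight_eq, mul_assoc, ← Real.exp_add]
        refine mul_le_mul_of_nonneg_left (Real.exp_le_exp.2 ?_) (walkProb_nonneg T f x σ)
        have h1 : β * J / 2 * (magnetization σ / n) ^ 2 - t * (magnetization σ / n) < b := by
          simpa using hσ
        have h2 := mul_le_mul_of_nonneg_left h1.le hn'.le
        have h3 : n * (t * (magnetization σ / n)) = t * magnetization σ := by field_simp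
        linarith
    _ ≤ ∑ σ : Config n,
          walkProb T f x σ * Real.exp (t * magnetization σ) * Real.exp (n * b) := by
        refine Finset.sum_le_sum_of_subset_of_nonneg (Finset.filter_subset _ _) fun σ _ _ => ?_
        have := walkProb_nonneg T f x σ
        positivity
    _ = Real.exp (n * Lam (empiricalMeasure T x n) f t + n * b) := by
        rw [← Finset.sum_mul, sum_walkProb_mul_exp T f x hn0, Real.exp_add]
    _ ≤ _ := by
        refine Real.exp_le_exp.2 ?_
        have h1 := mul_le_mul_of_nonneg_left hn.le hn'.le
        have h2 : Lam μ f t + η + b = -c := by rw [hb, hη]; ring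
        nlinarith

/-- The set `closure B ∩ [-1, 1]` is compact and is covered by finitely many of the neighbourhoods
above. Their number is absorbed by passing from the rate `c'` to the smaller `c`. -/
theorem eventually_gibbsMass_le [CompactSpace E] (hT : Continuous T) (hμ : UniquelyErgodic T μ)
    (hf : Continuous f) (β J : ℝ) (x : E) {B : Set ℝ} {c : ℝ}
    (hc : (c : EReal) < ⨅ z ∈ closure B, tiltedRate μ f β J z) :
    ∀ᶠ n : ℕ in atTop, gibbsMass T f β J x n B ≤ Real.exp (-(n * c)) := by
  obtain ⟨c', hcc', hc'⟩ := EReal.lt_iff_exists_real_btwn.1 hc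
  rw [EReal.coe_lt_coe_iff] at hcc'
  obtain ⟨N, hN⟩ : ∃ N : ℝ, ∀ᶠ n : ℕ in atTop,
      gibbsMass T f β J x n (closure B ∩ Set.Icc (-1) 1) ≤ N * Real.exp (-(n * c')) := by
    refine (isCompact_Icc.inter_left isClosed_closure).induction_on (p := fun S => ∃ N : ℝ,
      ∀ᶠ n : ℕ in atTop, gibbsMass T f β J x n S ≤ N * Real.exp (-(n * c')))
      ⟨0, by simp [gibbsMass]⟩ ?_ ?_ ?_
    · rintro S S' hS ⟨N, h⟩
      exact ⟨N, h.mono fun n hn => (gibbsMass_mono T f β J x n fun z hz _ => hS hz).trans hn⟩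
    · rintro S S' ⟨N, h⟩ ⟨N', h'⟩
      refine ⟨N + N', ?_⟩
      filter_upwards [h, h'] with n hn hn'
      refine (gibbsMass_union_le T f β J x n S S').trans ?_
      rw [add_mul]
      exact add_le_add hn hn'
    · rintro z ⟨hz, -⟩
      obtain ⟨V, hV, h⟩ := exists_nhds_gibbsMass_le hT hμ hf β J x (z := z) (c := c')
        (hc'.trans_le (iInf₂_le z hz))
      exact ⟨V, mem_nhdsWithin_of_mem_nhds hV, 1, by simpa using h⟩
  have hlarge : ∀ᶠ n : ℕ in atTop, N ≤ Real.exp (n * (c' - c)) := by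
    have h1 : Tendsto (fun n : ℕ => (n : ℝ) * (c' - c)) atTop atTop :=
      tendsto_natCast_atTop_atTop.atTop_mul_const (by linarith)
    exact (Real.tendsto_exp_atTop.comp h1).eventually_ge_atTop N
  filter_upwards [hN, hlarge] with n hn hl
  calc gibbsMass T f β J x n B ≤ gibbsMass T f β J x n (closure B ∩ Set.Icc (-1) 1) :=
        gibbsMass_mono T f β J x n fun z hz h1 => ⟨subset_closure hz, abs_le.1 h1⟩
    _ ≤ N * Real.exp (-(n * c')) := hn
    _ ≤ Real.exp (n * (c' - c)) * Real.exp (-(n * c')) := by gcongr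
    _ = _ := by rw [← Real.exp_add]; ring_nf

/-- Points with finite `Λ*` are limits of slopes `Λ'(t)` at which `Λ*` is not larger. -/
theorem exists_deriv_Lam_near (hf : Continuous f) {z ℓ : ℝ} (hℓ : ∀ t, t * z - Lam μ f t ≤ ℓ)
    {ρ : ℝ} (hρ : 0 < ρ) :
    ∃ t z' : ℝ, HasDerivAt (Lam μ f) z' t ∧ |z' - z| < ρ ∧ t * z' - Lam μ f t ≤ ℓ := by
  have hd : Differentiable ℝ (Lam μ f) := (contDiff_Lam μ hf).differentiable (by simp)
  have hℓ0 : 0 ≤ ℓ := by simpa [Lam_zero] using hℓ 0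
  -- The supremum defining `Λ*` need not be attained; the penalty `ε t² / 2` forces a minimizer `t`
  -- of `g`, with `Λ'(t) = z - ε t`. Comparison with `g 0 = 0` gives `ε t² ≤ 2 ℓ`, so `(ε t)² ≤ 2 ε
  -- ℓ < ρ²` for this `ε`. The slope lowers the Legendre value by `ε t² ≥ 0`.
  set ε := ρ ^ 2 / (2 * (ℓ + 1)) with hε
  have hε0 : 0 < ε := by positivity
  set g : ℝ → ℝ := fun t => Lam μ f t + ε / 2 * t ^ 2 - t * z with hg
  have hcont : Continuous g := by have := hd.continuous; fun_prop
  obtain ⟨t, ht⟩ := hcont.exists_forall_le' 0 (by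
    filter_upwards [(tendsto_norm_cocompact_atTop (E := ℝ)).eventually_ge_atTop
      (2 * (1 + |z|) / ε)] with t ht
    rw [div_le_iff₀ hε0, Real.norm_eq_abs] at ht
    have h1 := (abs_le.1 (abs_Lam_le μ f t)).1
    have h2 : t * z ≤ |t| * |z| := by rw [← abs_mul]; exact le_abs_self _
    simp only [hg, Lam_zero]
    rw [← sq_abs t]
    nlinarith [abs_nonneg t])
  have hder : HasDerivAt g (deriv (Lam μ f) t + ε * t - z) t := by
    have h1 := ((hd t).hasDerivAt.add ((hasDerivAt_pow 2 t).const_mul (ε / 2))).sub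
      ((hasDerivAt_id t).mul_const z)
    refine h1.congr_deriv ?_
    norm_num
    ring
  have hzero : deriv (Lam μ f) t + ε * t - z = 0 :=
    IsLocalMin.hasDerivAt_eq_zero (Eventually.of_forall ht) hder
  refine ⟨t, deriv (Lam μ f) t, (hd t).hasDerivAt, ?_, ?_⟩
  · have h0 := ht 0
    simp only [hg, Lam_zero] at h0
    have h1 := hℓ t
    have h2 : deriv (Lam μ f) t - z = -(ε * t) := by linarith
    rw [h2, abs_neg]
    refine abs_lt_of_sq_lt_sq ?_ hρ.le
    have h3 : ε * t ^ 2 ≤ 2 * ℓ := by nlinarith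
    have h4 : ε * (2 * (ℓ + 1)) = ρ ^ 2 := by rw [hε]; field_simp
    nlinarith
  · have h2 : deriv (Lam μ f) t = z - ε * t := by linarith
    have := hℓ t
    rw [h2]
    nlinarith [mul_nonneg hε0.le (sq_nonneg t)]

/-- Markov's inequality with an additional tilt `s`; its sign selects the right or the left tail. -/
theorem sum_walkProb_tail_le {x : E} {n : ℕ} (hn : n ≠ 0) (t s z r : ℝ) (A : Finset (Config n))
    (hA : ∀ σ ∈ A, |s| * r ≤ s * (magnetization σ / n - z)) :
    ∑ σ ∈ A, walkProb T f x σ * Real.exp (t * magnetization σ) ≤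
      Real.exp (n * (Lam (empiricalMeasure T x n) f (t + s) - s * z - |s| * r)) := by
  have hn' : (0 : ℝ) < n := by exact_mod_cast Nat.pos_of_ne_zero hn
  calc ∑ σ ∈ A, walkProb T f x σ * Real.exp (t * magnetization σ)
      ≤ ∑ σ ∈ A, walkProb T f x σ * Real.exp ((t + s) * magnetization σ) *
          Real.exp (-(n * (s * z + |s| * r))) := by
        refine Finset.sum_le_sum fun σ hσ => ?_
        rw [mul_assoc, ← Real.exp_add]
        refine mul_le_mul_of_nonneg_left (Real.exp_le_exp.2 ?_) (walkProb_nonneg T f x σ)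
        have h1 := mul_le_mul_of_nonneg_left (hA σ hσ) hn'.le
        have h2 : n * (s * (magnetization σ / n - z)) = s * magnetization σ - n * (s * z) := by
          field_simp
        linarith
    _ ≤ ∑ σ : Config n, walkProb T f x σ * Real.exp ((t + s) * magnetization σ) *
          Real.exp (-(n * (s * z + |s| * r))) := by
        refine Finset.sum_le_sum_of_subset_of_nonneg (Finset.subset_univ _) fun σ _ _ => ?_
        have := walkProb_nonneg T f x σ
        positivity
    _ = _ := by
        rw [← Finset.sum_mul, sum_walkProb_mul_exp T f x hn, ← Real.exp_add]
        congr 1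
        ring

open Classical in
/-- Under the exponentially tilted walk, `M_n / n` concentrates near `Λ'(t)`. -/
theorem eventually_half_le_sum_walkProb [CompactSpace E] (hT : Continuous T)
    (hμ : UniquelyErgodic T μ)
    (hf : Continuous f) (x : E) {t z r : ℝ} (hd : HasDerivAt (Lam μ f) z t) (hr : 0 < r) :
    ∀ᶠ n : ℕ in atTop, 1 / 2 * Real.exp (n * Lam (empiricalMeasure T x n) f t) ≤
      ∑ σ : Config n with |magnetization σ / n - z| < r,
        walkProb T f x σ * Real.exp (t * magnetization σ) := by
  -- Differentiability at `t` with slope `z` makes the additional tilts `±h` cost at most `r h / 2`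
  -- beyond the linear term, against a gain `r h` from the tail.
  have hlin : ∀ᶠ s in 𝓝 (0 : ℝ), |Lam μ f (t + s) - Lam μ f t - s * z| ≤ r / 2 * |s| := by
    have := (hasDerivAt_iff_isLittleO_nhds_zero.1 hd).def (half_pos hr)
    simpa using this
  obtain ⟨h, ⟨hs1, hs2⟩, hh⟩ : ∃ h : ℝ, (|Lam μ f (t + h) - Lam μ f t - h * z| ≤ r / 2 * |h| ∧
      |Lam μ f (t + -h) - Lam μ f t - -h * z| ≤ r / 2 * |-h|) ∧ 0 < h := by
    have hneg : Tendsto (fun s : ℝ => -s) (𝓝 0) (𝓝 0) := by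
      simpa using (continuous_neg.tendsto (0 : ℝ))
    exact (((hlin.and (hneg.eventually hlin)).filter_mono nhdsWithin_le_nhds).and
      (self_mem_nhdsWithin (s := Set.Ioi 0))).exists
  have htail : ∀ s : ℝ, |s| = h → |Lam μ f (t + s) - Lam μ f t - s * z| ≤ r / 2 * |s| →
      ∀ᶠ n : ℕ in atTop, ∀ A : Finset (Config n),
        (∀ σ ∈ A, |s| * r ≤ s * (magnetization σ / n - z)) →
        ∑ σ ∈ A, walkProb T f x σ * Real.exp (t * magnetization σ) ≤
          1 / 4 * Real.exp (n * Lam (empiricalMeasure T x n) f t) := by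
    -- The net gain `h r / 2` leaves room for the limit `n → ∞`: a gain `h r / 4` per site remains,
    -- so each tail eventually carries at most a quarter of the tilted mass, and the centre at least
    -- half.
    intro s hs hsl
    have hgap : Lam μ f (t + s) - Lam μ f t < s * z + |s| * r - h * r / 4 := by
      have := (abs_le.1 hsl).2
      rw [hs] at this ⊢
      nlinarith [mul_pos hh hr]
    have hconv := ((tendsto_Lam_empiricalMeasure hT hμ hf x (t + s)).sub
      (tendsto_Lam_empiricalMeasure hT hμ hf x t)).eventually_lt_const hgap
    have hsmall : ∀ᶠ n : ℕ in atTop, Real.exp (-(n * (h * r / 4))) ≤ 1 / 4 := by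
      have h1 : Tendsto (fun n : ℕ => (n : ℝ) * (h * r / 4)) atTop atTop :=
        tendsto_natCast_atTop_atTop.atTop_mul_const (by positivity)
      exact (Real.tendsto_exp_neg_atTop_nhds_zero.comp h1).eventually_le_const (by norm_num)
    filter_upwards [hconv, hsmall, eventually_ne_atTop 0] with n hn hsm hn0 A hA
    refine (sum_walkProb_tail_le hn0 t s z r A hA).trans ?_
    refine le_trans ?_ (mul_le_mul_of_nonneg_right hsm (Real.exp_pos _).le)
    rw [← Real.exp_add]
    refine Real.exp_le_exp.2 ?_
    have hn' : (0 : ℝ) ≤ n := Nat.cast_nonneg n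
    nlinarith
  filter_upwards [htail h (abs_of_pos hh) hs1, htail (-h) (by rw [abs_neg, abs_of_pos hh]) hs2,
    eventually_ne_atTop 0] with n h1 h2 hn0
  set q : Config n → ℝ := fun σ => walkProb T f x σ * Real.exp (t * magnetization σ) with hq
  have hq0 : ∀ σ, 0 ≤ q σ := fun σ => mul_nonneg (walkProb_nonneg T f x σ) (Real.exp_pos _).le
  have h3 := h1 (Finset.univ.filter fun σ => r ≤ magnetization σ / n - z) (fun σ hσ => by
    rw [abs_of_pos hh]
    exact mul_le_mul_of_nonneg_left (by simpa using hσ) hh.le)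
  have h4 := h2 (Finset.univ.filter fun σ => r ≤ -(magnetization σ / n - z)) (fun σ hσ => by
    rw [abs_neg, abs_of_pos hh, neg_mul_comm]
    exact mul_le_mul_of_nonneg_left (Finset.mem_filter.1 hσ).2 hh.le)
  have htotal : ∑ σ, q σ = Real.exp (n * Lam (empiricalMeasure T x n) f t) :=
    sum_walkProb_mul_exp T f x hn0 t
  have hle : ∑ σ, q σ ≤ (∑ σ : Config n with |magnetization σ / n - z| < r, q σ) +
      (∑ σ : Config n with r ≤ magnetization σ / n - z, q σ) +
      ∑ σ : Config n with r ≤ -(magnetization σ / n - z), q σ := by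
    simp only [Finset.sum_filter, ← Finset.sum_add_distrib]
    refine Finset.sum_le_sum fun σ _ => ?_
    have := hq0 σ
    by_cases ha : |magnetization σ / n - z| < r
    · simp only [ha, if_true]
      split_ifs <;> linarith
    · rw [not_lt, le_abs] at ha
      rcases ha with ha | ha
      · simp only [ha, if_true]
        split_ifs <;> linarith
      · simp only [ha, if_true]
        split_ifs <;> linarith
  linarith

/-- Change of measure: near `z` there is a slope `z' = Λ'(t)` of no larger Legendre value, and the
walk tilted by `t` concentrates at `z'`. On a small window around `z'` both the tilt and the
interaction are constant up to `η`, so undoing the tilt gives the bound. -/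
theorem eventually_le_gibbsMass [CompactSpace E] (hT : Continuous T) (hμ : UniquelyErgodic T μ)
    (hf : Continuous f) (β J : ℝ) (x : E) {U : Set ℝ} {z c : ℝ} (hU : U ∈ 𝓝 z)
    (hc : tiltedRate μ f β J z < c) :
    ∀ᶠ n : ℕ in atTop, Real.exp (-(n * c)) ≤ gibbsMass T f β J x n U := by
  classical
  obtain ⟨c', hc', hcc'⟩ := EReal.lt_iff_exists_real_btwn.1 hc
  rw [EReal.coe_lt_coe_iff] at hcc'
  rw [tiltedRate_eq_iSup] at hc'
  set F : ℝ → ℝ := fun w => β * J / 2 * w ^ 2 with hF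
  have hℓ : ∀ t, t * z - Lam μ f t ≤ c' + F z := fun t => by
    have := EReal.coe_le_coe_iff.1 (iSup_le_iff.1 hc'.le t)
    simp only [hF]
    linarith
  -- Four losses of size `η`: the interaction on the ball, the tilt on the window, the convergence
  -- of the empirical `Lam`, and the factor `1/2` from concentration.
  set η := (c - c') / 4 with hη
  have hη0 : 0 < η := by rw [hη]; linarith
  have hFc : Continuous F := by fun_prop
  obtain ⟨ρ, hρ, hball⟩ := Metric.mem_nhds_iff.1
    (inter_mem hU ((hFc.tendsto z).eventually_const_lt (sub_lt_self (F z) hη0)))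
  obtain ⟨t, z', hd, hz', htz⟩ := exists_deriv_Lam_near hf hℓ (half_pos hρ)
  -- The first bound keeps the window around `z'` inside the ball of radius `ρ` around `z`; the
  -- second makes `t (M_n / n - z')` at most `η`. The `+ 1` covers `t = 0`.
  set r := min (ρ / 2) (η / (|t| + 1)) with hr
  have ht1 : 0 < |t| + 1 := by positivity
  have hr0 : 0 < r := lt_min (half_pos hρ) (by positivity)
  have hlarge : ∀ᶠ n : ℕ in atTop, 2 ≤ Real.exp (n * η) := by
    have h1 : Tendsto (fun n : ℕ => (n : ℝ) * η) atTop atTop :=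
      tendsto_natCast_atTop_atTop.atTop_mul_const hη0
    exact (Real.tendsto_exp_atTop.comp h1).eventually_ge_atTop 2
  filter_upwards [eventually_half_le_sum_walkProb hT hμ hf x hd hr0, hlarge,
    (tendsto_Lam_empiricalMeasure hT hμ hf x t).eventually_const_lt (sub_lt_self _ hη0),
    eventually_ne_atTop 0] with n hn hl hL hn0
  have hn' : (0 : ℝ) < n := by exact_mod_cast Nat.pos_of_ne_zero hn0
  have hstep : (∑ σ : Config n with |magnetization σ / n - z'| < r,
      walkProb T f x σ * Real.exp (t * magnetization σ)) *
        Real.exp (n * (F z - 2 * η - t * z')) ≤ gibbsMass T f β J x n U := by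
    rw [Finset.sum_mul]
    refine le_trans (Finset.sum_le_sum fun σ hσ => (?_ : _ ≤ gibbsWeight T f β J x σ))
      (Finset.sum_le_sum_of_subset_of_nonneg (fun σ hσ => ?_)
        fun σ _ _ => gibbsWeight_nonneg T f β J x σ)
    all_goals
      have hσ' : |magnetization σ / n - z'| < r := (Finset.mem_filter.1 hσ).2
      have hmem : magnetization σ / n ∈ Metric.ball z ρ := by
        rw [Metric.mem_ball, Real.dist_eq]
        have h1 := abs_sub_le (magnetization σ / n) z' z
        have h2 := min_le_left (ρ / 2) (η / (|t| + 1))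
        linarith
    · rw [gibbsWeight_eq, mul_assoc, ← Real.exp_add]
      refine mul_le_mul_of_nonneg_left (Real.exp_le_exp.2 ?_) (walkProb_nonneg T f x σ)
      have h1 : F z - η < F (magnetization σ / n) := (hball hmem).2
      have h2 : t * (magnetization σ / n - z') ≤ η := by
        have h3 : |magnetization σ / n - z'| * (|t| + 1) ≤ η :=
          (le_div_iff₀ ht1).1 (hσ'.le.trans (min_le_right _ _))
        have h4 : t * (magnetization σ / n - z') ≤ |t| * |magnetization σ / n - z'| := by
          rw [← abs_mul]; exact le_abs_self _
        nlinarith [abs_nonneg (magnetization σ / n - z')]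
      have h5 : t * magnetization σ = n * (t * (magnetization σ / n)) := by field_simp
      rw [h5, ← mul_add]
      refine mul_le_mul_of_nonneg_left ?_ hn'.le
      change _ ≤ F (magnetization σ / n)
      linarith
    · exact Finset.mem_filter.2 ⟨Finset.mem_univ _, (hball hmem).1⟩
  refine le_trans ?_ ((mul_le_mul_of_nonneg_right hn (Real.exp_pos _).le).trans hstep)
  rw [mul_assoc, ← Real.exp_add]
  have h1 : -(n * c) + n * η ≤ n * Lam (empiricalMeasure T x n) f t +
      n * (F z - 2 * η - t * z') := by
    rw [← mul_add]
    have : -c + η ≤ Lam (empiricalMeasure T x n) f t + (F z - 2 * η - t * z') := by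
      rw [hη] at *
      linarith
    nlinarith
  have h2 := Real.exp_le_exp.2 h1
  rw [Real.exp_add] at h2
  have h3 := mul_le_mul_of_nonneg_left hl (Real.exp_pos (-(n * c))).le
  linarith

end Estimates

/-! ### The large deviation principle -/

theorem coe_le_one_div_mul_log_ofReal {n : ℕ} (hn : n ≠ 0) {q r : ℝ} (h : Real.exp (n * q) ≤ r) :
    (q : EReal) ≤ ((1 / (n : ℝ) : ℝ) : EReal) * ENNReal.log (ENNReal.ofReal r) := by
  have hn' : (0 : ℝ) < n := by exact_mod_cast Nat.pos_of_ne_zero hn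
  have h1 : ((n * q : ℝ) : EReal) ≤ ENNReal.log (ENNReal.ofReal r) := by
    rw [← Real.log_exp (n * q), ← ENNReal.log_ofReal_of_pos (Real.exp_pos _)]
    exact ENNReal.log_monotone (ENNReal.ofReal_le_ofReal h)
  calc (q : EReal) = ((1 / (n : ℝ) : ℝ) : EReal) * ((n * q : ℝ) : EReal) := by
        rw [← EReal.coe_mul]; congr 1; field_simp
    _ ≤ _ := mul_le_mul_of_nonneg_left h1 (EReal.coe_nonneg.2 (by positivity))

theorem one_div_mul_log_ofReal_le_coe {n : ℕ} (hn : n ≠ 0) {q r : ℝ} (h : r ≤ Real.exp (n * q)) :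
    ((1 / (n : ℝ) : ℝ) : EReal) * ENNReal.log (ENNReal.ofReal r) ≤ (q : EReal) := by
  have hn' : (0 : ℝ) < n := by exact_mod_cast Nat.pos_of_ne_zero hn
  have h1 : ENNReal.log (ENNReal.ofReal r) ≤ ((n * q : ℝ) : EReal) := by
    rw [← Real.log_exp (n * q), ← ENNReal.log_ofReal_of_pos (Real.exp_pos _)]
    exact ENNReal.log_monotone (ENNReal.ofReal_le_ofReal h)
  calc _ ≤ ((1 / (n : ℝ) : ℝ) : EReal) * ((n * q : ℝ) : EReal) :=
        mul_le_mul_of_nonneg_left h1 (EReal.coe_nonneg.2 (by positivity))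
    _ = q := by rw [← EReal.coe_mul]; congr 1; field_simp

section

variable {E : Type*} [MetricSpace E] [MeasurableSpace E] [BorelSpace E]
  {μ : Measure E} [IsProbabilityMeasure μ] {T : E → E} {f : E → unitInterval} {β J : ℝ}

/-- The infimum of `Λ*(w) - (β J / 2) w²` is finite. -/
theorem exists_iInf_tiltedRate_eq [CompactSpace E] (hT : Continuous T) (hμ : UniquelyErgodic T μ)
    (hf : Continuous f) (ha : 0 < β * J) (x : E) :
    ∃ k : ℝ, ⨅ w : ℝ, tiltedRate μ f β J w = k := by
  have hbot : ⨅ w : ℝ, tiltedRate μ f β J w ≠ ⊥ := fun h => by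
    have := le_iInf fun w => le_tiltedRate μ f ha w
    rw [h, le_bot_iff] at this
    exact EReal.coe_ne_bot _ this
  -- An infinite infimum would make the total mass at most `exp (-n)` eventually. But it is at least
  -- `1`, because the walk probabilities sum to `1` (moment generating function at `0`) and the
  -- interaction is nonnegative.
  have htop : ⨅ w : ℝ, tiltedRate μ f β J w ≠ ⊤ := fun h => by
    have h1 := eventually_gibbsMass_le hT hμ hf β J x (B := Set.univ) (c := 1) (by
      rw [closure_univ]
      simp only [Set.mem_univ, iInf_pos]
      rw [h]
      exact EReal.coe_lt_top 1)
    obtain ⟨n, hn, hn0⟩ := (h1.and (eventually_ne_atTop 0)).exists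
    have hn' : (0 : ℝ) < n := by exact_mod_cast Nat.pos_of_ne_zero hn0
    have h2 : 1 ≤ gibbsMass T f β J x n Set.univ := by
      have h3 := sum_walkProb_mul_exp T f x hn0 0
      simp only [zero_mul, Real.exp_zero, mul_one, Lam_zero, mul_zero] at h3
      rw [gibbsMass_univ, ← h3]
      refine Finset.sum_le_sum fun σ _ => ?_
      rw [gibbsWeight_eq]
      exact le_mul_of_one_le_right (walkProb_nonneg T f x σ) (Real.one_le_exp (by positivity))
    have h4 : Real.exp (-(n * 1)) < 1 :=
      (Real.exp_lt_exp.2 (by linarith)).trans_eq Real.exp_zero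
    linarith
  lift ⨅ w : ℝ, tiltedRate μ f β J w to ℝ using ⟨htop, hbot⟩ with k
  exact ⟨k, rfl⟩

/-- A probability is a quotient of Gibbs masses. The mass bounds for the whole line show that the
denominator decays at the rate `k`, the infimum of `tiltedRate`, and this is the constant subtracted
in `rateFunction`. -/
theorem largeDeviationPrinciple_magnetizationLaw [CompactSpace E] (hT : Continuous T)
    (hμ : UniquelyErgodic T μ)
    (hf : Continuous f) (ha : 0 < β * J) (x : E) :
    LargeDeviationPrinciple (fun n : ℕ => (magnetizationLaw T f β J x n : Measure ℝ))
      (fun n : ℕ => (n : ℝ)) (rateFunction μ f β J) := by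
  obtain ⟨k, hk⟩ := exists_iInf_tiltedRate_eq hT hμ hf ha x
  have hadd : ∀ {q : ℝ} {z : ℝ}, rateFunction μ f β J z < q →
    tiltedRate μ f β J z < (q + k : ℝ) := by
    intro q z h
    rwa [rateFunction, hk, EReal.sub_lt_iff (Or.inl (EReal.coe_ne_bot k))
      (Or.inl (EReal.coe_ne_top k)), ← EReal.coe_add] at h
  have hadd' : ∀ {q : ℝ} {z : ℝ}, (q : EReal) ≤ rateFunction μ f β J z →
      ((q + k : ℝ) : EReal) ≤ tiltedRate μ f β J z := by
    intro q z h
    contrapose! h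
    rwa [rateFunction, hk, EReal.sub_lt_iff (Or.inl (EReal.coe_ne_bot k))
      (Or.inl (EReal.coe_ne_top k)), ← EReal.coe_add]
  have hupZ : ∀ {k' : ℝ}, k' < k → ∀ᶠ n : ℕ in atTop,
      gibbsMass T f β J x n Set.univ ≤ Real.exp (-(n * k')) := by
    intro k' hk'
    refine eventually_gibbsMass_le hT hμ hf β J x ?_
    rw [closure_univ]
    simp only [Set.mem_univ, iInf_pos]
    rw [hk]
    exact EReal.coe_lt_coe_iff.2 hk'
  have hlowZ : ∀ {k' : ℝ}, k < k' → ∀ᶠ n : ℕ in atTop,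
      Real.exp (-(n * k')) ≤ gibbsMass T f β J x n Set.univ := by
    intro k' hk'
    obtain ⟨z, hz⟩ := iInf_lt_iff.1 (hk.trans_lt (EReal.coe_lt_coe_iff.2 hk'))
    exact eventually_le_gibbsMass hT hμ hf β J x univ_mem hz
  have hZpos : ∀ n, 0 < gibbsMass T f β J x n Set.univ := fun n => by
    rw [gibbsMass_univ]; exact sum_gibbsWeight_pos T f β J x n
  refine ⟨Nat.mono_cast, tendsto_natCast_atTop_atTop, isGoodRateFunction_rateFunction hk,
    fun B hB => ?_, fun B hB => ?_⟩
  · rw [EReal.neg_le]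
    refine le_iInf₂ fun z hz => ?_
    rw [EReal.neg_le]
    refine le_of_forall_lt fun y hy => ?_
    obtain ⟨q, hyq, hq⟩ := EReal.lt_iff_exists_real_btwn.1 hy
    refine hyq.trans_le (le_liminf_of_le (by isBoundedDefault) ?_)
    have h1 : rateFunction μ f β J z < (-q : ℝ) := by
      rw [EReal.coe_neg]; exact EReal.lt_neg_comm.1 hq
    -- The mass of `B` is at least `exp (-n c)` and, since `c + q < k`, the total mass is at most
    -- `exp (-n (c + q))`; the quotient is at least `exp (n q)`. The upper bound below uses the
    -- opposite inequalities.
    obtain ⟨c, hzc, hcq⟩ := EReal.lt_iff_exists_real_btwn.1 (hadd h1)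
    rw [EReal.coe_lt_coe_iff] at hcq
    filter_upwards [eventually_le_gibbsMass hT hμ hf β J x (mem_interior_iff_mem_nhds.1 hz) hzc,
      hupZ (by linarith : c + q < k), eventually_ne_atTop 0] with n hn1 hn2 hn0
    rw [magnetizationLaw_apply T f β J x n hB]
    refine coe_le_one_div_mul_log_ofReal hn0 ?_
    rw [le_div_iff₀ (hZpos n)]
    refine le_trans (mul_le_mul_of_nonneg_left hn2 (Real.exp_pos _).le) (le_trans (le_of_eq ?_) hn1)
    rw [← Real.exp_add]
    ring_nf
  · refine le_of_forall_gt fun y hy => ?_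
    obtain ⟨q, hq, hqy⟩ := EReal.lt_iff_exists_real_btwn.1 hy
    refine lt_of_le_of_lt (limsup_le_of_le (by isBoundedDefault) ?_) hqy
    have h1 : ((-q : ℝ) : EReal) < ⨅ z ∈ closure B, rateFunction μ f β J z := by
      rw [EReal.coe_neg]; exact EReal.neg_lt_comm.1 hq
    obtain ⟨q', hqq', hq'⟩ := EReal.lt_iff_exists_real_btwn.1 h1
    rw [EReal.coe_lt_coe_iff] at hqq'
    obtain ⟨c, hc1, hc2⟩ := exists_between (by linarith : k - q < q' + k)
    have h2 : (c : EReal) < ⨅ z ∈ closure B, tiltedRate μ f β J z :=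
      (EReal.coe_lt_coe_iff.2 hc2).trans_le
        (le_iInf₂ fun z hz => hadd' (hq'.le.trans (iInf₂_le z hz)))
    filter_upwards [eventually_gibbsMass_le hT hμ hf β J x h2,
      hlowZ (by linarith : k < c + q), eventually_ne_atTop 0] with n hn1 hn2 hn0
    rw [magnetizationLaw_apply T f β J x n hB]
    refine one_div_mul_log_ofReal_le_coe hn0 ?_
    rw [div_le_iff₀ (hZpos n)]
    refine hn1.trans (le_trans (le_of_eq ?_) (mul_le_mul_of_nonneg_left hn2 (Real.exp_pos _).le))
    rw [← Real.exp_add]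
    ring_nf

/-! ### Limits of the Gibbs expectations -/

theorem tendsto_integral_gibbsMeasure [CompactSpace E] (hT : Continuous T)
    (hμ : UniquelyErgodic T μ)
    (hf : Continuous f) (ha : 0 < β * J) (x : E) {M : Finset ℝ}
    (hM : (M : Set ℝ) = minimizers (G μ f β J)) (hMne : M.Nonempty)
    (hd : ∀ m ∈ M, ∀ j ∈ Finset.Icc 1 (minType (G μ f β J) m),
      (fun y : E => iteratedDeriv j (fun s : ℝ => L (f y) s) (β * J * m)) ∈
        DiscrepancyClass T μ ((j : ℝ) / (minType (G μ f β J) m : ℝ))) (h : ℝ →ᵇ ℝ) :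
    Tendsto (fun n : ℕ => (∫ σ, h (magnetization σ / n) ∂(gibbsMeasure T f β J x n)) -
      (∑ m ∈ M, weight μ T f β J x m n * h m) / ∑ m ∈ M, weight μ T f β J x m n)
      atTop (𝓝 0) := by
  simpa using (tendsto_integral_gibbsMeasure_sub T f ha x h).add
    (tendsto_integral_div_integral_sub hT hμ hf ha x hM hMne hd h)

theorem tendsto_magnetizationLaw_diracProba (hf : Continuous f) (ha : 0 < β * J) (x : E) {m : ℝ}
    (hm : m ∈ minimizers (G μ f β J))
    (hlim : ∀ h : ℝ →ᵇ ℝ,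
      Tendsto (fun n : ℕ => (∫ σ, h (magnetization σ / n) ∂(gibbsMeasure T f β J x n)) -
        (∑ m ∈ ({m} : Finset ℝ), weight μ T f β J x m n * h m) /
          ∑ m ∈ ({m} : Finset ℝ), weight μ T f β J x m n) atTop (𝓝 0)) :
    Tendsto (fun n : ℕ => magnetizationLaw T f β J x n) atTop (𝓝 (diracProba m)) := by
  rw [ProbabilityMeasure.tendsto_iff_forall_integral_tendsto]
  intro h
  have h1 := (hlim h).add_const (h m)
  rw [zero_add] at h1
  have h2 : ∫ y, h y ∂(diracProba m : Measure ℝ) = h m := integral_dirac h m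
  rw [h2]
  refine h1.congr' ?_
  filter_upwards [eventually_ne_atTop 0] with n hn
  have hw := (weight_pos (x := x) (T := T) hf ha hm hn).ne'
  rw [Finset.sum_singleton, Finset.sum_singleton, mul_div_cancel_left₀ _ hw, sub_add_cancel]
  exact (integral_map (measurable_of_finite _).aemeasurable
    h.continuous.aestronglyMeasurable).symm

end

end RandomFieldCurieWeiss

/-! ### The main theorem -/

open RandomFieldCurieWeiss in
theorem mainTheorem1 {E : Type*} [MetricSpace E] [CompactSpace E] [MeasurableSpace E]
    [BorelSpace E] (μ : Measure E) [IsProbabilityMeasure μ] (T : E → E) (hT : Continuous T)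
    (hμ : UniquelyErgodic T μ) (f : E → unitInterval) (hf : Continuous f) (β J : ℝ) (hβ : 0 < β)
    (hJ : 0 < J) (x : E) :
    (∃ M : Finset ℝ,
      (M : Set ℝ) = minimizers (G μ f β J) ∧ M.Nonempty ∧
      (∀ m ∈ M, 0 < minType (G μ f β J) m ∧ Even (minType (G μ f β J) m) ∧
        0 < minStrength (G μ f β J) m) ∧
      ((∀ m ∈ M, ∀ j ∈ Finset.Icc 1 (minType (G μ f β J) m),
          (fun y : E => iteratedDeriv j (fun s : ℝ => L (f y) s) (β * J * m)) ∈
            DiscrepancyClass T μ ((j : ℝ) / (minType (G μ f β J) m : ℝ))) →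
        (∀ h : ℝ →ᵇ ℝ,
          Tendsto
            (fun n : ℕ =>
              (∫ σ, h (magnetization σ / n) ∂(gibbsMeasure T f β J x n)) -
                (∑ m ∈ M, weight μ T f β J x m n * h m) / ∑ m ∈ M, weight μ T f β J x m n)
            atTop (𝓝 0)) ∧
        (∀ m : ℝ, M = {m} →
          Tendsto (fun n : ℕ => magnetizationLaw T f β J x n) atTop (𝓝 (diracProba m))))) ∧
    LargeDeviationPrinciple (fun n : ℕ => (magnetizationLaw T f β J x n : Measure ℝ))
      (fun n : ℕ => (n : ℝ)) (rateFunction μ f β J) := by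
  have ha : 0 < β * J := mul_pos hβ hJ
  have hfin := finite_minimizers_G μ hf ha
  have hM : (hfin.toFinset : Set ℝ) = minimizers (G μ f β J) := hfin.coe_toFinset
  have hMne : hfin.toFinset.Nonempty := hfin.toFinset_nonempty.2 (nonempty_minimizers_G μ hf ha)
  refine ⟨⟨hfin.toFinset, hM, hMne, fun m hm => ⟨minType_G_pos μ hf ha m,
    even_minType_G_and_minStrength_pos μ hf ha (hfin.mem_toFinset.1 hm)⟩, fun hd => ?_⟩,
    largeDeviationPrinciple_magnetizationLaw hT hμ hf ha x⟩
  have hlim := tendsto_integral_gibbsMeasure hT hμ hf ha x hM hMne hd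
  refine ⟨hlim, fun m hm => ?_⟩
  rw [hm] at hlim hM
  exact tendsto_magnetizationLaw_diracProba hf ha x (hM ▸ by simp) hlim
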